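/- **Setting.** Let $\mathcal H$ be a smooth $m$-dimensional manifold with boundary. Hypersurface data $\mathcal D=\{\mathcal H,\gamma,\ell,\ell^{(2)},Y\}$ consist of smooth fields: symmetric two-covariant tensors $\gamma,Y$, a one-form $\ell$ and a function $\ell^{(2)}$, such that $\mathcal A((W,a),(Z,b))=\gamma(W,Z)+a\ell(Z)+b\ell(W)+ab\,\ell^{(2)}$ is non-degenerate on every $T_p\mathcal H\times\mathbb R$. Its inverse $\mathcal A^\sharp((\alpha,a),(\beta,b))=P(\alpha,\beta)+a\,\beta(n)+b\,\alpha(n)+ab\,n^{(2)}$ defines a symmetric contravariant tensor $P$, a vector field $n$ and a function $n^{(2)}$. Put $K=n^{(2)}Y+\tfrac12\mathcal L_n\gamma+\ell\otimes_s dn^{(2)}$, $F=\tfrac12 d\ell$, $\Pi=Y+F$, $\omega=\tfrac12Y(n,n)$, and let $\overline\nabla$ be the torsion-free connection with $(\overline\nabla_X\gamma)(Z,W)=-\ell(Z)K(X,W)-\ell(W)K(X,Z)$ and $(\overline\nabla_X\ell)(Z)=Y(X,Z)+F(X,Z)-\ell^{(2)}K(X,Z)$; $\overline R^a{}_{bcd}$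 is its curvature, with $2\overline\nabla_{[c}\overline\nabla_{d]}v^a=\overline R^a{}_{bcd}v^b$, and $\square_Pf=P^{ab}\overline\nabla_a\overline\nabla_bf$. The constraint tensor is $\mathcal R_{ab}=B_{acbd}P^{cd}-(A_{bac}+A_{abc})n^c$ with $$A_{bcd}=\ell_a\overline R^a{}_{bcd}+2\ell^{(2)}\overline\nabla_{[d}K_{c]b}+K_{b[c}\overline\nabla_{d]}\ell^{(2)},\qquad B_{abcd}=\gamma_{af}\overline R^f{}_{bcd}+2\overline\nabla_{[d}(K_{c]b}\ell_a)+2\ell^{(2)}K_{b[c}K_{d]a}.$$ The data are *characteristic* (CHD) if $\gamma$ is positive semi-definite with $\operatorname{Rad}\gamma\ne\{0\}$ at every point and there is a *foliation function*, i.e. a smooth $u$ with $n(u)\neq0$ everywhere, whose level sets are all diffeomorphic. For a nowhere vanishing smooth function $z$ and a smooth vector field $\zeta$, the gauge transformed data are $\gamma'=\gamma$, $\ell'=z(\ell+\gamma(\zeta,\cdot))$, $\ell'^{(2)}=z^2(\ell^{(2)}+2\ell(\zeta)+\gamma(\zeta,\zeta))$, $Y'=zY+\ell\otimes_sdz+\tfrac12\mathcal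 L_{z\zeta}\gamma$. Let $\mathcal D,\underline{\mathcal D}$ be CHD on $\mathcal H,\underline{\mathcal H}$ (objects of $\underline{\mathcal D}$ are underlined), let $\mathcal S_0$ be a smooth manifold of dimension $m-1$ embedded in $\mathcal H$ and in $\underline{\mathcal H}$ with images $\partial\mathcal H$ and $\partial\underline{\mathcal H}$, and let $\mu$ be a smooth negative function on $\mathcal S_0$. A gauge is called *adapted* if $\ell|_{T\mathcal S_0}=\underline\ell|_{T\mathcal S_0}=0$ and $\ell^{(2)}=\underline\ell^{(2)}=0$ on $\mathcal S_0$. The triple $\{\mathcal D,\underline{\mathcal D},\mu\}$ is *double null data* (DND) if $\gamma$ and $\underline\gamma$ induce the same Riemannian metric on $\mathcal S_0$, $\mathcal R$ and $\underline{\mathcal R}$ have the same pullback to $\mathcal S_0$, and in every adapted gauge (with $\mu$ transformed into $z^{-1}\underline z^{-1}\mu$) one has on $\mathcal S_0$, for all $X,Z$ tangent to $\mathcal S_0$, $$\Pi(X,n)+\underline\Pi(X,\underline n)=-X(\log|\mu|),\qquad Y(X,Z)=\mu^{-1}\underline K(X,Z),\qquad \underline Y(X,Z)=\mu^{-1}K(X,Z).$$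 **Proposition.** Let $\{\mathcal D,\underline{\mathcal D},\mu\}$ be DND. Let $\underline u$ and $u$ be foliation functions on $\mathcal H$ and $\underline{\mathcal H}$, each constant on $\mathcal S_0$, and put $\lambda=n(\underline u)\ne0$, $\underline\lambda=\underline n(u)\neq0$. Let $U\subset\mathcal H$ and $\underline U\subset\underline{\mathcal H}$ be open (for instance $U=\mathcal H$, $\underline U=\underline{\mathcal H}$), and let $x^1,\dots,x^{m-1}$ and $\underline x^1,\dots,\underline x^{m-1}$ be smooth functions on $U$ and $\underline U$ such that $\{\underline u,x^A\}$ and $\{u,\underline x^A\}$ have linearly independent differentials at every point of $U$, respectively $\underline U$, and $x^A=\underline x^A$ on $\mathcal S_0\cap U\cap\underline U$. Suppose that the DND are written in the harmonic gauge, namely: * on $U$, $\operatorname{tr}_PK-4\omega=0$ and $2P(\overline\nabla_n\ell,\cdot)+n(\ell^{(2)})\,n=V$, where $V$ is the vector field with $V(\underline u)=\square_P\underline u$ and $V(x^A)=\square_Px^A$; and likewise for $\underline{\mathcal D}$ on $\underline U$ with $\{u,\underline x^A\}$; * $\ell|_{T\mathcal S_0}=\underline\ell|_{T\mathcal S_0}=0$,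 $\ell^{(2)}=\underline\ell^{(2)}=0$ and $\mu=\lambda=\underline\lambda$ on $\mathcal S_0$. Then at every point of $\mathcal S_0\cap U\cap\underline U$ and for every $X$ tangent to $\mathcal S_0$, $$2Y(n,n)=\underline\lambda\,\underline n(\underline\ell^{(2)}),\qquad 2\underline Y(\underline n,\underline n)=\lambda\,n(\ell^{(2)}),$$ $$2\Pi(X,n)=(\mathcal L_{\underline n}\underline\ell)(X)-X(\log|\underline\lambda|)-(\mathcal L_n\ell)(X),\qquad 2\underline\Pi(X,\underline n)=(\mathcal L_n\ell)(X)-X(\log|\lambda|)-(\mathcal L_{\underline n}\underline\ell)(X).$$ -/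

import Mathlib

open Set Function
open scoped Manifold ContDiff Topology

noncomputable section

/-! ### Linear algebra of hypersurface data at one point

For a symmetric bilinear form `γ`, a covector `ℓ` and a scalar `ℓ₂` on a vector space `V`, the
bilinear form `𝒜` on `V × ℝ` and the parts `P`, `n`, `n₂` of its inverse `𝒜♯`. -/

section Pointwise

variable {V : Type*} [NormedAddCommGroup V] [NormedSpace ℝ V]

/-- `𝒜((W,a),(Z,b)) = γ(W,Z) + a ℓ(Z) + b ℓ(W) + a b ℓ₂`. -/
def ambientForm (γ : V →L[ℝ] V →L[ℝ] ℝ) (ℓ : V →L[ℝ] ℝ) (ℓ₂ : ℝ) :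
    (V × ℝ) →L[ℝ] (V × ℝ) →L[ℝ] ℝ :=
  γ.bilinearComp (ContinuousLinearMap.fst ℝ V ℝ) (ContinuousLinearMap.fst ℝ V ℝ)
    + (ContinuousLinearMap.snd ℝ V ℝ).smulRight (ℓ.comp (ContinuousLinearMap.fst ℝ V ℝ))
    + (ℓ.comp (ContinuousLinearMap.fst ℝ V ℝ)).smulRight (ContinuousLinearMap.snd ℝ V ℝ)
    + ℓ₂ • (ContinuousLinearMap.snd ℝ V ℝ).smulRight (ContinuousLinearMap.snd ℝ V ℝ)

theorem ambientForm_apply (γ : V →L[ℝ] V →L[ℝ] ℝ) (ℓ : V →L[ℝ] ℝ) (ℓ₂ : ℝ) (W Z : V) (a b : ℝ) :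
    ambientForm γ ℓ ℓ₂ (W, a) (Z, b) = γ W Z + a * ℓ Z + b * ℓ W + a * b * ℓ₂ := by
  simp [ambientForm]; ring

/-- `𝒜♯`, as the map sending a covector of `V × ℝ` to the vector that it represents. -/
def ambientSharp (γ : V →L[ℝ] V →L[ℝ] ℝ) (ℓ : V →L[ℝ] ℝ) (ℓ₂ : ℝ) :
    ((V × ℝ) →L[ℝ] ℝ) →L[ℝ] V × ℝ :=
  (ambientForm γ ℓ ℓ₂).inverse

/-- The vector `n`. -/
def nVec (γ : V →L[ℝ] V →L[ℝ] ℝ) (ℓ : V →L[ℝ] ℝ) (ℓ₂ : ℝ) : V :=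
  (ambientSharp γ ℓ ℓ₂ (ContinuousLinearMap.snd ℝ V ℝ)).1

/-- The scalar `n⁽²⁾`. -/
def nScal (γ : V →L[ℝ] V →L[ℝ] ℝ) (ℓ : V →L[ℝ] ℝ) (ℓ₂ : ℝ) : ℝ :=
  (ambientSharp γ ℓ ℓ₂ (ContinuousLinearMap.snd ℝ V ℝ)).2

/-- The two-contravariant tensor `P`, as the map `α ↦ P(α, ·)`. -/
def PMap (γ : V →L[ℝ] V →L[ℝ] ℝ) (ℓ : V →L[ℝ] ℝ) (ℓ₂ : ℝ) (α : V →L[ℝ] ℝ) : V :=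
  (ambientSharp γ ℓ ℓ₂ (α.comp (ContinuousLinearMap.fst ℝ V ℝ))).1

end Pointwise

/-! ### Hypersurface data in a coordinate domain

`ChartData m` are the coordinate components of hypersurface data of dimension `m`. All derivatives
are taken within a set `s ⊆ ℝᵐ`, the half-space on which the charts of a manifold with boundary
live. Vectors `v, w, …` are to be read as constant coordinate vectors, so that, for instance,
`D.christoffel s y v w` is `v^a w^b Γ̄^c_{ab}(y)`. -/

/-- Coordinate space of dimension `m`. -/
abbrev Coord (m : ℕ) : Type := EuclideanSpace ℝ (Fin m)

/-- Components of the fields `γ`, `ℓ`, `ℓ⁽²⁾`, `Y` in coordinates. -/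
structure ChartData (m : ℕ) where
  γ : Coord m → Coord m →L[ℝ] Coord m →L[ℝ] ℝ
  ℓ : Coord m → Coord m →L[ℝ] ℝ
  ℓ₂ : Coord m → ℝ
  Y : Coord m → Coord m →L[ℝ] Coord m →L[ℝ] ℝ

/-- Coordinate basis vector `∂_a`. -/
def basisVec {m : ℕ} (a : Fin m) : Coord m := EuclideanSpace.single a 1

/-- Coordinate covector `dx^a`. -/
def basisCovec {m : ℕ} (a : Fin m) : Coord m →L[ℝ] ℝ := EuclideanSpace.proj a

/-- The Lie derivative `ℒ_Z T` of a two-covariant tensor field `T`, in coordinates. -/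
def lieTensor {m : ℕ} (s : Set (Coord m)) (Z : Coord m → Coord m)
    (T : Coord m → Coord m →L[ℝ] Coord m →L[ℝ] ℝ) (y : Coord m) :
    Coord m →L[ℝ] Coord m →L[ℝ] ℝ :=
  fderivWithin ℝ T s y (Z y)
    + (T y).bilinearComp (fderivWithin ℝ Z s y) (ContinuousLinearMap.id ℝ (Coord m))
    + (T y).bilinearComp (ContinuousLinearMap.id ℝ (Coord m)) (fderivWithin ℝ Z s y)

namespace ChartData

variable {m : ℕ} (D : ChartData m) (s : Set (Coord m))

/-- The vector field `n`. -/
def n (y : Coord m) : Coord m := nVec (D.γ y) (D.ℓ y) (D.ℓ₂ y)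

/-- The function `n⁽²⁾`. -/
def n₂ (y : Coord m) : ℝ := nScal (D.γ y) (D.ℓ y) (D.ℓ₂ y)

/-- The components `P^{ab}`. -/
def P (y : Coord m) (a b : Fin m) : ℝ :=
  basisCovec b (PMap (D.γ y) (D.ℓ y) (D.ℓ₂ y) (basisCovec a))

/-- `P^{ab} α_a ∂_b`. -/
def raise (y : Coord m) (α : Coord m → ℝ) : Coord m :=
  ∑ a, ∑ b, (D.P y a b * α (basisVec a)) • basisVec b

/-- `tr_P T = P^{ab} T_{ab}`. -/
def trP (y : Coord m) (T : Coord m → Coord m → ℝ) : ℝ :=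
  ∑ a, ∑ b, D.P y a b * T (basisVec a) (basisVec b)

/-- `K = n⁽²⁾ Y + ½ ℒ_n γ + ℓ ⊗_s dn⁽²⁾`. -/
def K (y v w : Coord m) : ℝ :=
  D.n₂ y * D.Y y v w + (1 / 2) * lieTensor s D.n D.γ y v w
    + (1 / 2) * (D.ℓ y v * fderivWithin ℝ D.n₂ s y w + D.ℓ y w * fderivWithin ℝ D.n₂ s y v)

/-- `F = ½ dℓ`. -/
def F (y v w : Coord m) : ℝ :=
  (1 / 2) * (fderivWithin ℝ D.ℓ s y v w - fderivWithin ℝ D.ℓ s y w v)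

/-- `Π = Y + F`. -/
def Pi (y v w : Coord m) : ℝ := D.Y y v w + D.F s y v w

/-- `(ℒ_n ℓ)(w)`. -/
def lieNell (y w : Coord m) : ℝ :=
  fderivWithin ℝ D.ℓ s y (D.n y) w + D.ℓ y (fderivWithin ℝ D.n s y w)

/-- The symbols
`Γ̄^c_{ab} = ½ P^{cd} (∂_a γ_{bd} + ∂_b γ_{ad} - ∂_d γ_{ab}) + n^c (½ (∂_a ℓ_b + ∂_b ℓ_a) - Y_{ab})`
of the torsion-free connection `∇̄` of the hypersurface data, that is, of the one with
`(∇̄_X γ)(Z,W) = -ℓ(Z) K(X,W) - ℓ(W) K(X,Z)` and `(∇̄_X ℓ)(Z) = Y(X,Z) + F(X,Z) - ℓ⁽²⁾ K(X,Z)`. -/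
def christoffel (y v w : Coord m) : Coord m :=
  D.raise y (fun z => (1 / 2) * (fderivWithin ℝ D.γ s y v w z + fderivWithin ℝ D.γ s y w v z
      - fderivWithin ℝ D.γ s y z v w))
    + ((1 / 2) * (fderivWithin ℝ D.ℓ s y v w + fderivWithin ℝ D.ℓ s y w v) - D.Y y v w) • D.n y

/-- `(∇̄_v ℓ)(w)`. -/
def covEll (y v w : Coord m) : ℝ := fderivWithin ℝ D.ℓ s y v w - D.ℓ y (D.christoffel s y v w)

/-- `(∇̄_v K)(a, b)`. -/
def covK (y v a b : Coord m) : ℝ :=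
  fderivWithin ℝ (fun y' => D.K s y' a b) s y v
    - D.K s y (D.christoffel s y v a) b - D.K s y a (D.christoffel s y v b)

/-- `R̄^f_{bcd} b^b c^c d^d ∂_f`, the value of the curvature operator `R̄(c, d)` of `∇̄` at `b`. -/
def riem (y b c d : Coord m) : Coord m :=
  fderivWithin ℝ (fun y' => D.christoffel s y' d b) s y c
    - fderivWithin ℝ (fun y' => D.christoffel s y' c b) s y d
    + D.christoffel s y c (D.christoffel s y d b) - D.christoffel s y d (D.christoffel s y c b)

/-- `A_{bcd} = ℓ_a R̄^a_{bcd} + 2 ℓ⁽²⁾ ∇̄_{[d} K_{c]b} + K_{b[c} ∇̄_{d]} ℓ⁽²⁾`. -/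
def A (y b c d : Coord m) : ℝ :=
  D.ℓ y (D.riem s y b c d) + D.ℓ₂ y * (D.covK s y d c b - D.covK s y c d b)
    + (1 / 2) * (D.K s y b c * fderivWithin ℝ D.ℓ₂ s y d - D.K s y b d * fderivWithin ℝ D.ℓ₂ s y c)

/-- `B_{abcd} = γ_{af} R̄^f_{bcd} + 2 ∇̄_{[d} (K_{c]b} ℓ_a) + 2 ℓ⁽²⁾ K_{b[c} K_{d]a}`. -/
def B (y a b c d : Coord m) : ℝ :=
  D.γ y a (D.riem s y b c d)
    + ((D.covK s y d c b * D.ℓ y a + D.K s y c b * D.covEll s y d a)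
      - (D.covK s y c d b * D.ℓ y a + D.K s y d b * D.covEll s y c a))
    + D.ℓ₂ y * (D.K s y b c * D.K s y d a - D.K s y b d * D.K s y c a)

/-- The constraint tensor `ℛ_{ab} = B_{acbd} P^{cd} - (A_{bac} + A_{abc}) n^c`. -/
def ric (y a b : Coord m) : ℝ :=
  D.trP y (fun c d => D.B s y a c b d) - (D.A s y b a (D.n y) + D.A s y a b (D.n y))

/-- `∇̄_v ∇̄_w f`, the Hessian of a function. -/
def hess (f : Coord m → ℝ) (y v w : Coord m) : ℝ :=
  fderivWithin ℝ (fun y' => fderivWithin ℝ f s y' w) s y v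
    - fderivWithin ℝ f s y (D.christoffel s y v w)

/-- `□_P f = P^{ab} ∇̄_a ∇̄_b f`. -/
def boxP (f : Coord m → ℝ) (y : Coord m) : ℝ := D.trP y (D.hess s f y)

/-- `2 P(∇̄_n ℓ, ·) + n(ℓ⁽²⁾) n`. -/
def harmonicVec (y : Coord m) : Coord m :=
  (2 : ℝ) • D.raise y (D.covEll s y (D.n y)) + fderivWithin ℝ D.ℓ₂ s y (D.n y) • D.n y

end ChartData

/-! ### Hypersurface data on a manifold with boundary

The manifold `H` has dimension `k + 1`. The tangent space of `H` at `p` is by definition the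
coordinate space, by means of the preferred chart at `p`; the value at `p` of a tensor is computed
from the components of the data in that chart. -/

section Manifold

variable {k : ℕ} {H : Type*} [TopologicalSpace H] [ChartedSpace (EuclideanHalfSpace (k + 1)) H]

/-- Fields `γ` (two-covariant), `ℓ` (one-form), `ℓ⁽²⁾` (scalar), `Y` (two-covariant) on `H`. -/
structure HypersurfaceData (k : ℕ) (H : Type*) [TopologicalSpace H]
    [ChartedSpace (EuclideanHalfSpace (k + 1)) H] where
  γ : ∀ p : H, TangentSpace (𝓡∂ (k + 1)) p →L[ℝ] TangentSpace (𝓡∂ (k + 1)) p →L[ℝ] ℝ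
  ℓ : ∀ p : H, TangentSpace (𝓡∂ (k + 1)) p →L[ℝ] ℝ
  ℓ₂ : H → ℝ
  Y : ∀ p : H, TangentSpace (𝓡∂ (k + 1)) p →L[ℝ] TangentSpace (𝓡∂ (k + 1)) p →L[ℝ] ℝ

/-- The half-space in which the charts of `H` take their values. -/
def halfSpace (k : ℕ) : Set (Coord (k + 1)) := range (𝓡∂ (k + 1))

/-- The differential at `y` of the inverse of the preferred chart at `p`. -/
def chartFrame (p : H) (y : Coord (k + 1)) :
    Coord (k + 1) →L[ℝ] TangentSpace (𝓡∂ (k + 1)) ((extChartAt (𝓡∂ (k + 1)) p).symm y) :=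
  mfderivWithin 𝓘(ℝ, Coord (k + 1)) (𝓡∂ (k + 1)) (extChartAt (𝓡∂ (k + 1)) p).symm (halfSpace k) y

/-- The components of a one-form in the preferred chart at `p`. -/
def covecInChart (α : ∀ p : H, TangentSpace (𝓡∂ (k + 1)) p →L[ℝ] ℝ) (p : H) (y : Coord (k + 1)) :
    Coord (k + 1) →L[ℝ] ℝ :=
  (α ((extChartAt (𝓡∂ (k + 1)) p).symm y)).comp (chartFrame p y)

/-- The components of a two-covariant tensor field in the preferred chart at `p`. -/
def tensorInChart
    (T : ∀ p : H, TangentSpace (𝓡∂ (k + 1)) p →L[ℝ] TangentSpace (𝓡∂ (k + 1)) p →L[ℝ] ℝ)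
    (p : H) (y : Coord (k + 1)) : Coord (k + 1) →L[ℝ] Coord (k + 1) →L[ℝ] ℝ :=
  (ContinuousLinearMap.precomp ℝ (chartFrame p y)).comp
    ((T ((extChartAt (𝓡∂ (k + 1)) p).symm y)).comp (chartFrame p y))

/-- The components of a vector field in the preferred chart at `p`. -/
def vecInChart (ζ : ∀ p : H, TangentSpace (𝓡∂ (k + 1)) p) (p : H) (y : Coord (k + 1)) :
    Coord (k + 1) :=
  (chartFrame p y).inverse (ζ ((extChartAt (𝓡∂ (k + 1)) p).symm y))

theorem tensorInChart_apply
    (T : ∀ p : H, TangentSpace (𝓡∂ (k + 1)) p →L[ℝ] TangentSpace (𝓡∂ (k + 1)) p →L[ℝ] ℝ)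
    (p : H) (y v w : Coord (k + 1)) :
    tensorInChart T p y v w =
      T ((extChartAt (𝓡∂ (k + 1)) p).symm y) (chartFrame p y v) (chartFrame p y w) := rfl

/-- The Lie derivative `ℒ_ζ T` of a two-covariant tensor field `T`. -/
def lieDerivTensor (ζ : ∀ p : H, TangentSpace (𝓡∂ (k + 1)) p)
    (T : ∀ p : H, TangentSpace (𝓡∂ (k + 1)) p →L[ℝ] TangentSpace (𝓡∂ (k + 1)) p →L[ℝ] ℝ) (p : H) :
    TangentSpace (𝓡∂ (k + 1)) p →L[ℝ] TangentSpace (𝓡∂ (k + 1)) p →L[ℝ] ℝ :=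
  lieTensor (halfSpace k) (vecInChart ζ p) (tensorInChart T p) (extChartAt (𝓡∂ (k + 1)) p p)

namespace HypersurfaceData

variable (D : HypersurfaceData k H)

/-- The components of the data in the preferred chart at `p`. -/
def inChart (p : H) : ChartData (k + 1) where
  γ := tensorInChart D.γ p
  ℓ := covecInChart D.ℓ p
  ℓ₂ := fun y => D.ℓ₂ ((extChartAt (𝓡∂ (k + 1)) p).symm y)
  Y := tensorInChart D.Y p

/-- The vector field `n`. -/
def n (p : H) : TangentSpace (𝓡∂ (k + 1)) p := (D.inChart p).n (extChartAt (𝓡∂ (k + 1)) p p)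

/-- The tensor `K`. -/
def K (p : H) (v w : TangentSpace (𝓡∂ (k + 1)) p) : ℝ :=
  (D.inChart p).K (halfSpace k) (extChartAt (𝓡∂ (k + 1)) p p) v w

/-- The tensor `Π = Y + ½ dℓ`. -/
def Pi (p : H) (v w : TangentSpace (𝓡∂ (k + 1)) p) : ℝ :=
  (D.inChart p).Pi (halfSpace k) (extChartAt (𝓡∂ (k + 1)) p p) v w

/-- The one-form `ℒ_n ℓ`. -/
def lieNell (p : H) (w : TangentSpace (𝓡∂ (k + 1)) p) : ℝ :=
  (D.inChart p).lieNell (halfSpace k) (extChartAt (𝓡∂ (k + 1)) p p) w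

/-- The constraint tensor `ℛ`. -/
def ric (p : H) (v w : TangentSpace (𝓡∂ (k + 1)) p) : ℝ :=
  (D.inChart p).ric (halfSpace k) (extChartAt (𝓡∂ (k + 1)) p p) v w

/-- The function `tr_P K`. -/
def trK (p : H) : ℝ :=
  (D.inChart p).trP (extChartAt (𝓡∂ (k + 1)) p p)
    ((D.inChart p).K (halfSpace k) (extChartAt (𝓡∂ (k + 1)) p p))

/-- The function `ω = ½ Y(n, n)`. -/
def omega (p : H) : ℝ := (1 / 2) * D.Y p (D.n p) (D.n p)

/-- The function `□_P f`. -/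
def boxP (f : H → ℝ) (p : H) : ℝ :=
  (D.inChart p).boxP (halfSpace k) (fun y => f ((extChartAt (𝓡∂ (k + 1)) p).symm y))
    (extChartAt (𝓡∂ (k + 1)) p p)

/-- The vector field `2 P(∇̄_n ℓ, ·) + n(ℓ⁽²⁾) n`. -/
def harmonicVec (p : H) : TangentSpace (𝓡∂ (k + 1)) p :=
  (D.inChart p).harmonicVec (halfSpace k) (extChartAt (𝓡∂ (k + 1)) p p)

/-- The gauge transformed data `𝒢_{(z,ζ)} D`. -/
def gauge (z : H → ℝ) (ζ : ∀ p : H, TangentSpace (𝓡∂ (k + 1)) p) : HypersurfaceData k H where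
  γ := D.γ
  ℓ := fun p => z p • (D.ℓ p + D.γ p (ζ p))
  ℓ₂ := fun p => z p ^ 2 * (D.ℓ₂ p + 2 * D.ℓ p (ζ p) + D.γ p (ζ p) (ζ p))
  Y := fun p => z p • D.Y p
    + (1 / 2 : ℝ) • ((D.ℓ p).smulRight (mvfderiv (𝓡∂ (k + 1)) z p)
      + (mvfderiv (𝓡∂ (k + 1)) z p).smulRight (D.ℓ p))
    + (1 / 2 : ℝ) • lieDerivTensor (fun q => z q • ζ q) D.γ p

/-- Hypersurface data: smooth fields, `γ` and `Y` symmetric, `𝒜` non-degenerate at every point. -/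
structure IsHypersurfaceData : Prop where
  smooth_γ : ∀ p, ContDiffOn ℝ ∞ (tensorInChart D.γ p) (extChartAt (𝓡∂ (k + 1)) p).target
  smooth_ℓ : ∀ p, ContDiffOn ℝ ∞ (covecInChart D.ℓ p) (extChartAt (𝓡∂ (k + 1)) p).target
  smooth_ℓ₂ : ContMDiff (𝓡∂ (k + 1)) 𝓘(ℝ, ℝ) ∞ D.ℓ₂
  smooth_Y : ∀ p, ContDiffOn ℝ ∞ (tensorInChart D.Y p) (extChartAt (𝓡∂ (k + 1)) p).target
  symm_γ : ∀ p v w, D.γ p v w = D.γ p w v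
  symm_Y : ∀ p v w, D.Y p v w = D.Y p w v
  nondeg : ∀ (p : H) (W : TangentSpace (𝓡∂ (k + 1)) p) (a : ℝ),
    (∀ (Z : TangentSpace (𝓡∂ (k + 1)) p) (b : ℝ),
      D.γ p W Z + a * D.ℓ p Z + b * D.ℓ p W + a * b * D.ℓ₂ p = 0) → W = 0 ∧ a = 0

/-- The function `λ = n(u)`. -/
def lam (u : H → ℝ) (p : H) : ℝ := mvfderiv (𝓡∂ (k + 1)) u p (D.n p)

/-- A foliation function: a smooth function `u` with `n(u) ≠ 0` everywhere. -/
def IsFoliationFunction (u : H → ℝ) : Prop :=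
  ContMDiff (𝓡∂ (k + 1)) 𝓘(ℝ, ℝ) ∞ u ∧ ∀ p, D.lam u p ≠ 0

end HypersurfaceData

/-- Any two (non-empty) level sets of `u` are diffeomorphic. -/
def LeavesDiffeomorphic (u : H → ℝ) : Prop :=
  ∀ a ∈ range u, ∀ b ∈ range u, ∃ f g : H → H,
    ContMDiffOn (𝓡∂ (k + 1)) (𝓡∂ (k + 1)) ∞ f (u ⁻¹' {a}) ∧
    ContMDiffOn (𝓡∂ (k + 1)) (𝓡∂ (k + 1)) ∞ g (u ⁻¹' {b}) ∧
    MapsTo f (u ⁻¹' {a}) (u ⁻¹' {b}) ∧ MapsTo g (u ⁻¹' {b}) (u ⁻¹' {a}) ∧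
    InvOn g f (u ⁻¹' {a}) (u ⁻¹' {b})

namespace HypersurfaceData

variable (D : HypersurfaceData k H)

/-- Characteristic hypersurface data (CHD). -/
structure IsCHD : Prop extends D.IsHypersurfaceData where
  rad_ne : ∀ p, ∃ X : TangentSpace (𝓡∂ (k + 1)) p, X ≠ 0 ∧ ∀ Z, D.γ p X Z = 0
  semipos : ∀ p X, 0 ≤ D.γ p X X
  foliated : ∃ u : H → ℝ, D.IsFoliationFunction u ∧ LeavesDiffeomorphic (k := k) u

/-- The data are written in a harmonic gauge on `U` with respect to the functions `x`: there,
`tr_P K - 4 ω = 0` and `2 P(∇̄_n ℓ, ·) + n(ℓ⁽²⁾) n = V`, where `V` is the vector field with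
components `V(x^a) = □_P x^a`. -/
structure IsHarmonicGaugeOn (x : Fin (k + 1) → H → ℝ) (U : Set H) : Prop where
  trace_eq : ∀ p ∈ U, D.trK p - 4 * D.omega p = 0
  vector_eq : ∃ V : ∀ p : H, TangentSpace (𝓡∂ (k + 1)) p, ∀ p ∈ U,
    (∀ a, mvfderiv (𝓡∂ (k + 1)) (x a) p (V p) = D.boxP (x a) p) ∧ D.harmonicVec p = V p

end HypersurfaceData

/-- Smooth functions on the open set `U` that are independent (independent differentials). -/
structure IsIndependentOn (x : Fin (k + 1) → H → ℝ) (U : Set H) : Prop where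
  smooth : ∀ a, ContMDiffOn (𝓡∂ (k + 1)) 𝓘(ℝ, ℝ) ∞ (x a) U
  indep : ∀ p ∈ U, LinearIndependent ℝ (fun a => mvfderiv (𝓡∂ (k + 1)) (x a) p)

/-- Gauge parameters: a smooth nowhere vanishing function and a smooth vector field. -/
structure IsGaugeParam [IsManifold (𝓡∂ (k + 1)) ∞ H] (z : H → ℝ)
    (ζ : ∀ p : H, TangentSpace (𝓡∂ (k + 1)) p) : Prop where
  smooth_z : ContMDiff (𝓡∂ (k + 1)) 𝓘(ℝ, ℝ) ∞ z
  ne_zero : ∀ p, z p ≠ 0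
  smooth_ζ : ContMDiff (𝓡∂ (k + 1)) (𝓡∂ (k + 1)).tangent ∞
    (fun p => (⟨p, ζ p⟩ : TangentBundle (𝓡∂ (k + 1)) H))

end Manifold

/-! ### Double null data -/

section Double

variable {k : ℕ} {S : Type*} [TopologicalSpace S] [ChartedSpace (EuclideanSpace ℝ (Fin k)) S]
  {H H₁ H₂ : Type*} [TopologicalSpace H] [ChartedSpace (EuclideanHalfSpace (k + 1)) H]
  [TopologicalSpace H₁] [ChartedSpace (EuclideanHalfSpace (k + 1)) H₁]
  [TopologicalSpace H₂] [ChartedSpace (EuclideanHalfSpace (k + 1)) H₂]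

/-- The push-forward of `X ∈ T_s S` by `i : S → H`. -/
def push (i : S → H) (s : S) (X : TangentSpace (𝓡 k) s) : TangentSpace (𝓡∂ (k + 1)) (i s) :=
  mfderiv (𝓡 k) (𝓡∂ (k + 1)) i s X

/-- The gauge conditions `ℓ_∥ = 0` and `ℓ⁽²⁾ = 0` on the image of `i : S → H`. -/
def IsAdapted (D : HypersurfaceData k H) (i : S → H) : Prop :=
  (∀ s X, D.ℓ (i s) (push i s X) = 0) ∧ ∀ s, D.ℓ₂ (i s) = 0

/-- The compatibility conditions of double null data on the common boundary `S`:
`Π(X,n) + Π̲(X,n̲) = -X(log|μ|)`, `Y(X,Z) = μ⁻¹ K̲(X,Z)` and `Y̲(X,Z) = μ⁻¹ K(X,Z)`. -/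
structure IsCompatible (D₁ : HypersurfaceData k H₁) (D₂ : HypersurfaceData k H₂)
    (i₁ : S → H₁) (i₂ : S → H₂) (μ : S → ℝ) : Prop where
  torsion : ∀ s X, D₁.Pi (i₁ s) (push i₁ s X) (D₁.n (i₁ s))
    + D₂.Pi (i₂ s) (push i₂ s X) (D₂.n (i₂ s))
      = - mvfderiv (𝓡 k) (fun s' => Real.log |μ s'|) s X
  Y₁_eq : ∀ s X Z, D₁.Y (i₁ s) (push i₁ s X) (push i₁ s Z)
    = (μ s)⁻¹ * D₂.K (i₂ s) (push i₂ s X) (push i₂ s Z)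
  Y₂_eq : ∀ s X Z, D₂.Y (i₂ s) (push i₂ s X) (push i₂ s Z)
    = (μ s)⁻¹ * D₁.K (i₁ s) (push i₁ s X) (push i₁ s Z)

/-- Double null data (DND) `{D₁, D₂, μ}` with boundary embeddings `i₁ : S → H₁`, `i₂ : S → H₂`.
The compatibility conditions are required of the gauge transformed triple in every gauge with
`ℓ_∥ = ℓ̲_∥ = 0` and `ℓ⁽²⁾ = ℓ̲⁽²⁾ = 0` on `S`; `μ` transforms into `z⁻¹ z̲⁻¹ μ`. -/
structure IsDoubleNullData [IsManifold (𝓡 k) ∞ S] [IsManifold (𝓡∂ (k + 1)) ∞ H₁]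
    [IsManifold (𝓡∂ (k + 1)) ∞ H₂] (D₁ : HypersurfaceData k H₁) (D₂ : HypersurfaceData k H₂)
    (i₁ : S → H₁) (i₂ : S → H₂) (μ : S → ℝ) : Prop where
  chd₁ : D₁.IsCHD
  chd₂ : D₂.IsCHD
  smooth_μ : ContMDiff (𝓡 k) 𝓘(ℝ, ℝ) ∞ μ
  μ_neg : ∀ s, μ s < 0
  embed₁ : Manifold.IsSmoothEmbedding (𝓡 k) (𝓡∂ (k + 1)) ∞ i₁
  embed₂ : Manifold.IsSmoothEmbedding (𝓡 k) (𝓡∂ (k + 1)) ∞ i₂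
  range₁ : range i₁ = (𝓡∂ (k + 1)).boundary H₁
  range₂ : range i₂ = (𝓡∂ (k + 1)).boundary H₂
  metric_eq : ∀ s X Z, D₁.γ (i₁ s) (push i₁ s X) (push i₁ s Z)
    = D₂.γ (i₂ s) (push i₂ s X) (push i₂ s Z)
  metric_pos : ∀ s X, X ≠ 0 → 0 < D₁.γ (i₁ s) (push i₁ s X) (push i₁ s X)
  ric_eq : ∀ s X Z, D₁.ric (i₁ s) (push i₁ s X) (push i₁ s Z)
    = D₂.ric (i₂ s) (push i₂ s X) (push i₂ s Z)
  compatible : ∀ z₁ ζ₁ z₂ ζ₂, IsGaugeParam z₁ ζ₁ → IsGaugeParam z₂ ζ₂ →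
    IsAdapted (D₁.gauge z₁ ζ₁) i₁ → IsAdapted (D₂.gauge z₂ ζ₂) i₂ →
    IsCompatible (D₁.gauge z₁ ζ₁) (D₂.gauge z₂ ζ₂) i₁ i₂
      (fun s => (z₁ (i₁ s))⁻¹ * (z₂ (i₂ s))⁻¹ * μ s)

end Double

end

/-! On the common boundary everything reduces to the geometry of the induced metric `h`. Since `γ`
is degenerate, `n⁽²⁾ = 0`, so `γ(n,·) = 0` and `ℓ(n) = 1`. In an adapted gauge the tangent space of
the hypersurface splits as `ker ℓ ⊕ ⟨n⟩`, with `ker ℓ` the tangent space of the boundary, and `P` is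
the inverse of `h` on the first summand (`AdaptedSlice.PMap_eq_sum`).

The central computation is a Gauss formula, `AdaptedSlice.hess_tangent`: on boundary vectors the
`∇̄`-Hessian of `f` is its `h`-Hessian plus `n(f) Y`. Tracing gives `□_P f = □_h f + n(f) tr_P Y`.
The vector condition of the harmonic gauge, applied to `f`, then reads `2 P(∇̄_n ℓ, df) + n(ℓ⁽²⁾)
n(f) = □_h f + n(f) tr_P Y`.

For the foliation function, constant on the boundary, only the terms with `n(f) ≠ 0` survive, whence
`n(ℓ⁽²⁾) = tr_P Y` (`n_ell₂_eq_sum`). Compatibility turns `tr_P Y` into `μ⁻¹ tr K` of the other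
data, and the trace condition evaluates that as `4 μ⁻¹ ω = 2 μ⁻¹ Y(n,n)` of the other data. These
are the two scalar identities.

For the functions `x^A` the `n(f)` terms now cancel, leaving `2 h⁻¹(∇̄_n ℓ, dx^A) = □_h x^A`
(`harmonic_slice`). The right side is the same for both data, and the `dx^A` separate boundary
vectors, so the tangential parts of the two one-forms `∇̄_n ℓ` coincide
(`IsDoubleNullData.nablaNEll_eq`). As `(∇̄_n ℓ)(X) = Π(X,n) + (ℒ_n ℓ)(X)`, this fixes the difference
of the two torsion terms. Compatibility fixes their sum, and the last two identities follow. -/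

section PointwiseLemmas

/-! ### Linear algebra of `𝒜` and its inverse at a point -/

variable {V : Type*} [NormedAddCommGroup V] [NormedSpace ℝ V]
  {γ : V →L[ℝ] V →L[ℝ] ℝ} {ℓ : V →L[ℝ] ℝ} {ℓ₂ : ℝ}

/-- `ambientSharp` is built from the total function `inverse`, which is zero off the invertible
maps, so invertibility is needed by all that follows. In finite dimension it reduces to a trivial
kernel. -/
theorem ambientForm_isInvertible [FiniteDimensional ℝ V]
    (h : ∀ (W : V) (a : ℝ), (∀ (Z : V) (b : ℝ), γ W Z + a * ℓ Z + b * ℓ W + a * b * ℓ₂ = 0) →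
      W = 0 ∧ a = 0) : (ambientForm γ ℓ ℓ₂).IsInvertible := by
  have hinj : Injective (ambientForm γ ℓ ℓ₂).toLinearMap := by
    rw [injective_iff_map_eq_zero]
    rintro ⟨W, a⟩ h0
    have := h W a fun Z b => by
      rw [← ambientForm_apply]
      exact congrArg (fun f : (V × ℝ) →L[ℝ] ℝ => f (Z, b)) h0
    simp [this.1, this.2]
  have hdim : Module.finrank ℝ (V × ℝ) = Module.finrank ℝ ((V × ℝ) →L[ℝ] ℝ) := by
    rw [← (LinearMap.toContinuousLinearMap (𝕜 := ℝ) (E := V × ℝ) (F' := ℝ)).finrank_eq]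
    exact (Subspace.dual_finrank_eq (K := ℝ) (V := V × ℝ)).symm
  refine ⟨(LinearEquiv.ofInjectiveOfFinrankEq _ hinj hdim).toContinuousLinearEquiv, ?_⟩
  exact ContinuousLinearMap.ext fun x => rfl

theorem ambientSharp_eq (h : (ambientForm γ ℓ ℓ₂).IsInvertible) {ξ : (V × ℝ) →L[ℝ] ℝ} {x : V × ℝ}
    (hx : ∀ Z b, ambientForm γ ℓ ℓ₂ x (Z, b) = ξ (Z, b)) : ambientSharp γ ℓ ℓ₂ ξ = x := by
  have : ξ = ambientForm γ ℓ ℓ₂ x := by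
    refine ContinuousLinearMap.ext fun ⟨Z, b⟩ => (hx Z b).symm
  rw [this]
  exact h.inverse_apply_self x

theorem ambientForm_nVec (h : (ambientForm γ ℓ ℓ₂).IsInvertible) (Z : V) (b : ℝ) :
    γ (nVec γ ℓ ℓ₂) Z + nScal γ ℓ ℓ₂ * ℓ Z + b * ℓ (nVec γ ℓ ℓ₂) + nScal γ ℓ ℓ₂ * b * ℓ₂ = b := by
  rw [← ambientForm_apply]
  exact congrArg (fun f : (V × ℝ) →L[ℝ] ℝ => f (Z, b))
    (h.self_apply_inverse (ContinuousLinearMap.snd ℝ V ℝ))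

/-- The two equations say that `(v, c)` represents the covector `(α, 0)` under `𝒜`; the scalar `c`
is then forgotten. -/
theorem PMap_eq (h : (ambientForm γ ℓ ℓ₂).IsInvertible) {α : V →L[ℝ] ℝ} {v : V} {c : ℝ}
    (h1 : ∀ Z, γ v Z + c * ℓ Z = α Z) (h2 : ℓ v + c * ℓ₂ = 0) : PMap γ ℓ ℓ₂ α = v := by
  have : ambientSharp γ ℓ ℓ₂ (α.comp (ContinuousLinearMap.fst ℝ V ℝ)) = (v, c) := by
    refine ambientSharp_eq h fun Z b => ?_
    rw [ambientForm_apply]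
    simp only [ContinuousLinearMap.comp_apply, ContinuousLinearMap.coe_fst']
    linear_combination h1 Z + b * h2
  simp [PMap, this]

/-- If `γ` is degenerate, then `n⁽²⁾ = 0`. -/
theorem nScal_eq_zero (h : (ambientForm γ ℓ ℓ₂).IsInvertible) (hs : ∀ v w, γ v w = γ w v)
    {X : V} (hX : X ≠ 0) (hrad : ∀ Z, γ X Z = 0) : nScal γ ℓ ℓ₂ = 0 := by
  have h1 := ambientForm_nVec h X 0
  rw [hs, hrad] at h1
  simp only [zero_add, zero_mul, mul_zero, add_zero, mul_eq_zero] at h1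
  -- If also `ℓ X = 0`, then `(X, 0)` would lie in the kernel of `𝒜`.
  refine h1.resolve_right fun h0 => hX ?_
  have : ambientForm γ ℓ ℓ₂ (X, 0) = 0 := by
    refine ContinuousLinearMap.ext fun ⟨Z, b⟩ => ?_
    rw [ambientForm_apply]
    simp [hrad, h0]
  have h2 := h.injective (this.trans (map_zero _).symm)
  exact (Prod.ext_iff.1 h2).1

theorem gamma_nVec (h : (ambientForm γ ℓ ℓ₂).IsInvertible) (h0 : nScal γ ℓ ℓ₂ = 0) (Z : V) :
    γ (nVec γ ℓ ℓ₂) Z = 0 := by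
  simpa [h0] using ambientForm_nVec h Z 0

theorem ell_nVec (h : (ambientForm γ ℓ ℓ₂).IsInvertible) (h0 : nScal γ ℓ ℓ₂ = 0) :
    ℓ (nVec γ ℓ ℓ₂) = 1 := by
  simpa [h0] using ambientForm_nVec h 0 1

/-- `𝒜` depends linearly on `(γ, ℓ, ℓ⁽²⁾)`, and inversion is smooth at invertible maps. -/
theorem contDiffWithinAt_nVec {E : Type*} [NormedAddCommGroup E] [NormedSpace ℝ E]
    [FiniteDimensional ℝ V] {N : WithTop ℕ∞}
    {g : E → V →L[ℝ] V →L[ℝ] ℝ} {l : E → V →L[ℝ] ℝ} {l₂ : E → ℝ} {s : Set E} {y : E}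
    (hg : ContDiffWithinAt ℝ N g s y) (hl : ContDiffWithinAt ℝ N l s y)
    (hl₂ : ContDiffWithinAt ℝ N l₂ s y) (h : (ambientForm (g y) (l y) (l₂ y)).IsInvertible) :
    ContDiffWithinAt ℝ N (fun z => nVec (g z) (l z) (l₂ z)) s y := by
  have : CompleteSpace V := FiniteDimensional.complete ℝ V
  have hform : ContDiffWithinAt ℝ N (fun z => ambientForm (g z) (l z) (l₂ z)) s y := by
    have e : (fun z => ambientForm (g z) (l z) (l₂ z)) = fun z =>
        (g z).bilinearComp (ContinuousLinearMap.fst ℝ V ℝ) (ContinuousLinearMap.fst ℝ V ℝ)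
        + ContinuousLinearMap.smulRightL ℝ (V × ℝ) ((V × ℝ) →L[ℝ] ℝ)
            (ContinuousLinearMap.snd ℝ V ℝ) ((l z).comp (ContinuousLinearMap.fst ℝ V ℝ))
        + ContinuousLinearMap.smulRightL ℝ (V × ℝ) ((V × ℝ) →L[ℝ] ℝ)
            ((l z).comp (ContinuousLinearMap.fst ℝ V ℝ)) (ContinuousLinearMap.snd ℝ V ℝ)
        + ContinuousLinearMap.smulRight (ContinuousLinearMap.id ℝ ℝ)
            ((ContinuousLinearMap.snd ℝ V ℝ).smulRight (ContinuousLinearMap.snd ℝ V ℝ)) (l₂ z) :=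
      rfl
    have hb : ContDiffWithinAt ℝ N (fun z => (g z).bilinearComp (ContinuousLinearMap.fst ℝ V ℝ)
        (ContinuousLinearMap.fst ℝ V ℝ)) s y := by
      have e' : (fun z => (g z).bilinearComp (ContinuousLinearMap.fst ℝ V ℝ)
          (ContinuousLinearMap.fst ℝ V ℝ)) = fun z =>
          (ContinuousLinearMap.precomp ℝ (ContinuousLinearMap.fst ℝ V ℝ)).comp
            ((g z).comp (ContinuousLinearMap.fst ℝ V ℝ)) := rfl
      rw [e']
      exact contDiffWithinAt_const.clm_comp (hg.clm_comp contDiffWithinAt_const)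
    rw [e]
    have hc := hl.clm_comp (contDiffWithinAt_const (c := ContinuousLinearMap.fst ℝ V ℝ))
    exact ((hb.add (contDiffWithinAt_const.clm_apply hc)).add
      ((contDiffWithinAt_const.clm_apply hc).clm_apply contDiffWithinAt_const)).add
      ((ContinuousLinearMap.contDiff _).comp_contDiffWithinAt hl₂)
  have hinv := h.contDiffAt_map_inverse (n := N)
  exact (((hinv.comp_contDiffWithinAt y hform).clm_apply contDiffWithinAt_const).fst)

end PointwiseLemmas

/-! ### The boundary as a slice of a coordinate domain: splitting and traces -/

/-- Local coordinates `φ` near `x₀` of a hypersurface `{φ(x)}` on which `ℓ_∥ = 0` and `ℓ⁽²⁾ = 0`,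
inside a coordinate domain `s` with characteristic hypersurface data. -/
structure AdaptedSlice {k : ℕ} (D : ChartData (k + 1)) (s : Set (Coord (k + 1)))
    (φ : Coord k → Coord (k + 1)) (x₀ : Coord k) : Prop where
  uniq : UniqueDiffOn ℝ s
  mem : ∀ᶠ x in 𝓝 x₀, φ x ∈ s
  smooth : ContDiffAt ℝ 2 φ x₀
  diff_γ : DifferentiableWithinAt ℝ D.γ s (φ x₀)
  diff_ℓ : DifferentiableWithinAt ℝ D.ℓ s (φ x₀)
  diff_n : DifferentiableWithinAt ℝ D.n s (φ x₀)
  symm_γ : ∀ v w, D.γ (φ x₀) v w = D.γ (φ x₀) w v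
  symm_Y : ∀ v w, D.Y (φ x₀) v w = D.Y (φ x₀) w v
  invertible : (ambientForm (D.γ (φ x₀)) (D.ℓ (φ x₀)) (D.ℓ₂ (φ x₀))).IsInvertible
  γ_n : ∀ w, D.γ (φ x₀) (D.n (φ x₀)) w = 0
  ℓ_n : ∀ᶠ y in 𝓝[s] (φ x₀), D.ℓ y (D.n y) = 1
  ℓ₂_zero : D.ℓ₂ (φ x₀) = 0
  ℓ_tangent : ∀ᶠ x in 𝓝 x₀, ∀ w, D.ℓ (φ x) (fderiv ℝ φ x w) = 0
  pos : ∀ v, v ≠ 0 → 0 < D.γ (φ x₀) (fderiv ℝ φ x₀ v) (fderiv ℝ φ x₀ v)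

/-- The metric induced by `γ` along `φ`. -/
noncomputable def inducedMetric {k m : ℕ} (D : ChartData m) (φ : Coord k → Coord m) (x v w : Coord k) : ℝ :=
  D.γ (φ x) (fderiv ℝ φ x v) (fderiv ℝ φ x w)

/-- The Gram matrix of a bilinear form in coordinate space. -/
noncomputable def gram {k : ℕ} (h : Coord k → Coord k → ℝ) : Matrix (Fin k) (Fin k) ℝ :=
  Matrix.of fun i j => h (basisVec i) (basisVec j)

/-- The Christoffel symbols of the first kind of a metric. -/
noncomputable def koszul {k : ℕ} (h : Coord k → Coord k → Coord k → ℝ) (x v w u : Coord k) : ℝ :=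
  (1 / 2) * (fderiv ℝ (fun x' => h x' w u) x v + fderiv ℝ (fun x' => h x' v u) x w
    - fderiv ℝ (fun x' => h x' v w) x u)

theorem coord_eq_sum {m : ℕ} (v : Coord m) : v = ∑ a, v a • basisVec a := by
  have := (EuclideanSpace.basisFun (Fin m) ℝ).sum_repr v
  simpa [basisVec] using this.symm

namespace IsLinearMap

theorem eq_sum {m : ℕ} {α : Coord m → ℝ} (hα : IsLinearMap ℝ α) (v : Coord m) :
    α v = ∑ a, v a * α (basisVec a) := by
  conv_lhs => rw [coord_eq_sum v, ← hα.mk'_apply, map_sum]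
  simp

end IsLinearMap

theorem clm_comp_eq_sum {l m : ℕ} (α : Coord m →L[ℝ] ℝ) (L : Coord l →L[ℝ] Coord m)
    (v : Coord l) : α (L v) = ∑ a, v a * α (L (basisVec a)) :=
  IsLinearMap.eq_sum (α := fun v => α (L v)) (α.comp L).toLinearMap.isLinear v

/-- The target `G` is left general so that the same product rule serves `ℓ` and `df` (real values)
as well as `γ` (covector values). -/
theorem hasFDerivAt_covec_comp {E F G : Type*} [NormedAddCommGroup E] [NormedSpace ℝ E]
    [NormedAddCommGroup F] [NormedSpace ℝ F] [NormedAddCommGroup G] [NormedSpace ℝ G]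
    {φ : E → F} {x₀ : E} {s : Set F} {β : F → F →L[ℝ] G}
    (hφ : ContDiffAt ℝ 2 φ x₀) (hs : ∀ᶠ x in 𝓝 x₀, φ x ∈ s)
    (hβ : DifferentiableWithinAt ℝ β s (φ x₀)) (w : E) :
    HasFDerivAt (fun x => β (φ x) (fderiv ℝ φ x w))
      (((fderivWithin ℝ β s (φ x₀)).comp (fderiv ℝ φ x₀)).flip (fderiv ℝ φ x₀ w)
        + (β (φ x₀)).comp ((fderiv ℝ (fderiv ℝ φ) x₀).flip w)) x₀ := by
  have h1 : HasFDerivAt φ (fderiv ℝ φ x₀) x₀ := (hφ.differentiableAt (by norm_num)).hasFDerivAt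
  have h2 : HasFDerivAt (fun x => β (φ x)) ((fderivWithin ℝ β s (φ x₀)).comp (fderiv ℝ φ x₀)) x₀ :=
    hβ.hasFDerivWithinAt.comp_hasFDerivAt x₀ h1 hs
  have h3 : HasFDerivAt (fderiv ℝ φ) (fderiv ℝ (fderiv ℝ φ) x₀) x₀ :=
    ((hφ.fderiv_right (m := 1) (by norm_num)).differentiableAt (by norm_num)).hasFDerivAt
  have h4 := h2.clm_apply (h3.clm_apply (hasFDerivAt_const w x₀))
  refine h4.congr_fderiv ?_
  ext v
  simp [add_comm]

namespace AdaptedSlice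

variable {k : ℕ} {D : ChartData (k + 1)} {s : Set (Coord (k + 1))} {φ : Coord k → Coord (k + 1)}
  {x₀ : Coord k}

theorem mem_self (H : AdaptedSlice D s φ x₀) : φ x₀ ∈ s := H.mem.self_of_nhds

theorem ell_n (H : AdaptedSlice D s φ x₀) : D.ℓ (φ x₀) (D.n (φ x₀)) = 1 :=
  H.ℓ_n.self_of_nhdsWithin H.mem_self

theorem ell_tangent (H : AdaptedSlice D s φ x₀) (w : Coord k) :
    D.ℓ (φ x₀) (fderiv ℝ φ x₀ w) = 0 := H.ℓ_tangent.self_of_nhds w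

/-- A vector is the sum of a tangent vector of the slice and a multiple of `n`. -/
theorem exists_decomp (H : AdaptedSlice D s φ x₀) (Z : Coord (k + 1)) :
    ∃ (v : Coord k) (c : ℝ), Z = fderiv ℝ φ x₀ v + c • D.n (φ x₀) := by
  let L : (Coord k × ℝ) →ₗ[ℝ] Coord (k + 1) :=
    (fderiv ℝ φ x₀).toLinearMap.coprod (LinearMap.toSpanSingleton ℝ _ (D.n (φ x₀)))
  -- Applying `ℓ` to `L (v, c)` recovers `c`, and positivity of the induced metric then kills `v`;
  -- surjectivity is a dimension count.
  have hL : ∀ v c, L (v, c) = fderiv ℝ φ x₀ v + c • D.n (φ x₀) := fun v c => by simp [L]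
  have hinj : Injective L := by
    rw [injective_iff_map_eq_zero]
    rintro ⟨v, c⟩ h0
    rw [hL] at h0
    have hc : c = 0 := by
      have := congrArg (D.ℓ (φ x₀)) h0
      simpa [H.ell_n, H.ell_tangent] using this
    have hv : v = 0 := by
      by_contra hv
      have h1 := H.pos v hv
      rw [hc, zero_smul, add_zero] at h0
      simp [h0] at h1
    simp [hc, hv]
  have hdim : Module.finrank ℝ (Coord k × ℝ) = Module.finrank ℝ (Coord (k + 1)) := by simp
  obtain ⟨⟨v, c⟩, h⟩ := (LinearMap.injective_iff_surjective_of_finrank_eq_finrank hdim).1 hinj Z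
  exact ⟨v, c, by rw [← h, hL]⟩

/-- The `γ`-components and the `ℓ`-component determine a vector. -/
theorem ext_vec (H : AdaptedSlice D s φ x₀) {Z W : Coord (k + 1)}
    (h1 : ∀ l, D.γ (φ x₀) Z (fderiv ℝ φ x₀ (basisVec l))
      = D.γ (φ x₀) W (fderiv ℝ φ x₀ (basisVec l)))
    (h2 : D.ℓ (φ x₀) Z = D.ℓ (φ x₀) W) : Z = W := by
  obtain ⟨v, c, h⟩ := H.exists_decomp (Z - W)
  have hc : c = 0 := by
    have := congrArg (D.ℓ (φ x₀)) h
    simpa [H.ell_n, H.ell_tangent, h2] using this.symm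
  have hv : v = 0 := by
    by_contra hv
    refine (H.pos v hv).ne' ?_
    have h3 : fderiv ℝ φ x₀ v = Z - W := by rw [h, hc]; simp
    rw [clm_comp_eq_sum]
    refine Finset.sum_eq_zero fun l _ => ?_
    rw [h3]
    simp [h1 l]
  rw [← sub_eq_zero, h, hc, hv]
  simp

variable {g : Matrix (Fin k) (Fin k) ℝ}

theorem isUnit_gram (H : AdaptedSlice D s φ x₀) :
    IsUnit (gram (inducedMetric D φ x₀)) := by
  rw [← Matrix.mulVec_injective_iff_isUnit, ← Matrix.coe_mulVecLin, injective_iff_map_eq_zero]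
  intro c hc
  by_contra hne
  have hv : (WithLp.toLp 2 c : Coord k) ≠ 0 := fun h => hne (by simpa using h)
  refine (H.pos _ hv).ne' ?_
  rw [← ContinuousLinearMap.flip_apply, clm_comp_eq_sum]
  refine Finset.sum_eq_zero fun i _ => ?_
  have h2 := congrFun hc i
  simp only [Matrix.mulVecLin_apply, Matrix.mulVec, dotProduct, gram, Matrix.of_apply,
    inducedMetric, Pi.zero_apply] at h2
  rw [ContinuousLinearMap.flip_apply, clm_comp_eq_sum]
  simp only [mul_comm (c _)] at h2 ⊢
  rw [h2, zero_mul]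

/-- A left inverse of the Gram matrix is all that is used; symmetry of `g` is never needed. -/
theorem sum_gram (hg : g * gram (inducedMetric D φ x₀) = 1) (a : Fin k → ℝ) (l : Fin k) :
    ∑ i, ∑ j, g i j * a i * D.γ (φ x₀) (fderiv ℝ φ x₀ (basisVec j)) (fderiv ℝ φ x₀ (basisVec l))
      = a l := by
  have h : ∀ i, ∑ j, g i j * D.γ (φ x₀) (fderiv ℝ φ x₀ (basisVec j))
      (fderiv ℝ φ x₀ (basisVec l)) = if i = l then 1 else 0 := fun i => by
    rw [← Matrix.one_apply, ← hg]
    rfl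
  calc _ = ∑ i, a i * ∑ j, g i j * D.γ (φ x₀) (fderiv ℝ φ x₀ (basisVec j))
        (fderiv ℝ φ x₀ (basisVec l)) := by
        simp only [Finset.mul_sum]
        refine Finset.sum_congr rfl fun i _ => Finset.sum_congr rfl fun j _ => by ring
    _ = a l := by simp [h]

/-- `P` is the inverse of the induced metric. -/
theorem PMap_eq_sum (H : AdaptedSlice D s φ x₀) (hg : g * gram (inducedMetric D φ x₀) = 1)
    (α : Coord (k + 1) →L[ℝ] ℝ) :
    PMap (D.γ (φ x₀)) (D.ℓ (φ x₀)) (D.ℓ₂ (φ x₀)) α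
      = ∑ i, ∑ j, (g i j * α (fderiv ℝ φ x₀ (basisVec i))) • fderiv ℝ φ x₀ (basisVec j) := by
  -- The scalar is forced: pairing the first equation with `n` gives `c = α(n)`, because `γ(·,n) =
  -- 0` and `ℓ(n) = 1`.
  refine PMap_eq (c := α (D.n (φ x₀))) H.invertible (fun Z => ?_) ?_
  · obtain ⟨v, c, rfl⟩ := H.exists_decomp Z
    have hn : ∀ w, D.γ (φ x₀) w (D.n (φ x₀)) = 0 := fun w => by rw [H.symm_γ, H.γ_n]
    rw [map_add, map_smul, hn, clm_comp_eq_sum, map_add, map_smul, map_add, map_smul,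
      clm_comp_eq_sum α, H.ell_tangent, H.ell_n]
    simp only [map_sum, map_smul, sum_apply, smul_apply, smul_eq_mul, sum_gram hg]
    ring
  · simp [H.ell_tangent, H.ℓ₂_zero]

theorem P_eq_sum (H : AdaptedSlice D s φ x₀) (hg : g * gram (inducedMetric D φ x₀) = 1)
    (a b : Fin (k + 1)) : D.P (φ x₀) a b = ∑ i, ∑ j, g i j *
      fderiv ℝ φ x₀ (basisVec i) a * fderiv ℝ φ x₀ (basisVec j) b := by
  rw [ChartData.P, H.PMap_eq_sum hg]
  simp [basisCovec]

theorem trP_eq_sum (H : AdaptedSlice D s φ x₀) (hg : g * gram (inducedMetric D φ x₀) = 1)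
    {T : Coord (k + 1) → Coord (k + 1) → ℝ} (h1 : ∀ v, IsLinearMap ℝ (T v))
    (h2 : ∀ w, IsLinearMap ℝ fun v => T v w) : D.trP (φ x₀) T = ∑ i, ∑ j, g i j *
      T (fderiv ℝ φ x₀ (basisVec i)) (fderiv ℝ φ x₀ (basisVec j)) := by
  have e : ∀ v w, T v w = ∑ a, ∑ b, v a * w b * T (basisVec a) (basisVec b) := fun v w => by
    rw [(h2 w).eq_sum v]
    refine Finset.sum_congr rfl fun a _ => ?_
    rw [(h1 _).eq_sum w, Finset.mul_sum]
    exact Finset.sum_congr rfl fun b _ => by ring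
  simp only [ChartData.trP, H.P_eq_sum hg]
  simp_rw [e (fderiv ℝ φ x₀ _) (fderiv ℝ φ x₀ _), Finset.mul_sum, Finset.sum_mul]
  calc _ = ∑ a : Fin (k + 1), ∑ i, ∑ b : Fin (k + 1), ∑ j, g i j *
        fderiv ℝ φ x₀ (basisVec i) a * fderiv ℝ φ x₀ (basisVec j) b
          * T (basisVec a) (basisVec b) :=
        Finset.sum_congr rfl fun a _ => Finset.sum_comm
    _ = ∑ i, ∑ a : Fin (k + 1), ∑ j, ∑ b : Fin (k + 1), g i j *
        fderiv ℝ φ x₀ (basisVec i) a * fderiv ℝ φ x₀ (basisVec j) b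
          * T (basisVec a) (basisVec b) := by
        rw [Finset.sum_comm]
        exact Finset.sum_congr rfl fun i _ => Finset.sum_congr rfl fun a _ => Finset.sum_comm
    _ = _ := by
        refine Finset.sum_congr rfl fun i _ => ?_
        rw [Finset.sum_comm]
        exact Finset.sum_congr rfl fun j _ => Finset.sum_congr rfl fun a _ =>
          Finset.sum_congr rfl fun b _ => by ring

theorem apply_raise (H : AdaptedSlice D s φ x₀) (hg : g * gram (inducedMetric D φ x₀) = 1)
    {α : Coord (k + 1) → ℝ} (hα : IsLinearMap ℝ α) (β : Coord (k + 1) →L[ℝ] ℝ) :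
    β (D.raise (φ x₀) α) = ∑ i, ∑ j, g i j *
      (α (fderiv ℝ φ x₀ (basisVec i)) * β (fderiv ℝ φ x₀ (basisVec j))) := by
  -- Raising `α` and pairing with `β` is the `P`-trace of the rank-one tensor `α ⊗ β`.
  rw [← H.trP_eq_sum hg (T := fun v w => α v * β w)
    (fun v => ⟨fun x y => by simp [mul_add], fun c x => by simp; ring⟩)
    (fun w => ⟨fun x y => by simp [hα.map_add, add_mul], fun c x => by simp [hα.map_smul]; ring⟩)]
  simp [ChartData.raise, ChartData.trP, mul_assoc]

/-- The decomposition of a vector into its tangential part and its `n`-part. -/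
theorem decomp (H : AdaptedSlice D s φ x₀) (hg : g * gram (inducedMetric D φ x₀) = 1)
    (W : Coord (k + 1)) :
    W = ∑ i, ∑ j, (g i j * D.γ (φ x₀) W (fderiv ℝ φ x₀ (basisVec i))) • fderiv ℝ φ x₀ (basisVec j)
      + D.ℓ (φ x₀) W • D.n (φ x₀) := by
  refine H.ext_vec (fun l => ?_) ?_
  · rw [map_add, map_smul, add_apply, smul_apply, H.γ_n]
    simp only [map_sum, map_smul, sum_apply, smul_apply, smul_eq_mul, mul_zero, add_zero]
    rw [sum_gram hg (fun i => D.γ (φ x₀) W (fderiv ℝ φ x₀ (basisVec i)))]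
  · simp [H.ell_tangent, H.ell_n]

end AdaptedSlice

/-! ### Linearity of the coordinate expressions -/

namespace ChartData

variable {m : ℕ} (D : ChartData m) (s : Set (Coord m)) (y : Coord m)

theorem raise_add (α β : Coord m → ℝ) :
    D.raise y (fun z => α z + β z) = D.raise y α + D.raise y β := by
  simp only [raise, mul_add, add_smul, Finset.sum_add_distrib]

theorem raise_smul (c : ℝ) (α : Coord m → ℝ) :
    D.raise y (fun z => c * α z) = c • D.raise y α := by
  simp only [raise, Finset.smul_sum, smul_smul]
  refine Finset.sum_congr rfl fun a _ => Finset.sum_congr rfl fun b _ => ?_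
  congr 1
  ring

theorem isLinearMap_christoffel_right (v : Coord m) :
    IsLinearMap ℝ (D.christoffel s y v) where
  map_add w w' := by
    simp only [christoffel]
    rw [add_add_add_comm, ← raise_add, ← add_smul]
    congr 2
    · ext z; simp; ring
    · simp; ring
  map_smul c w := by
    simp only [christoffel]
    rw [smul_add, ← raise_smul, smul_smul]
    congr 2
    · ext z; simp; ring
    · simp; ring

theorem isLinearMap_christoffel_left (w : Coord m) :
    IsLinearMap ℝ fun v => D.christoffel s y v w where
  map_add v v' := by
    simp only [christoffel]
    rw [add_add_add_comm, ← raise_add, ← add_smul]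
    congr 2
    · ext z; simp; ring
    · simp; ring
  map_smul c v := by
    simp only [christoffel]
    rw [smul_add, ← raise_smul, smul_smul]
    congr 2
    · ext z; simp; ring
    · simp; ring

theorem isLinearMap_covEll (v : Coord m) : IsLinearMap ℝ (D.covEll s y v) where
  map_add w w' := by
    simp only [covEll, (D.isLinearMap_christoffel_right s y v).map_add, map_add]; ring
  map_smul c w := by
    simp only [covEll, (D.isLinearMap_christoffel_right s y v).map_smul, map_smul, smul_eq_mul]
    ring

theorem isLinearMap_K_right (v : Coord m) : IsLinearMap ℝ (D.K s y v) where
  map_add w w' := by simp only [K, map_add]; ring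
  map_smul c w := by simp only [K, map_smul, smul_eq_mul]; ring

theorem isLinearMap_K_left (w : Coord m) : IsLinearMap ℝ fun v => D.K s y v w where
  map_add v v' := by simp only [K, map_add, add_apply]; ring
  map_smul c v := by simp only [K, map_smul, smul_apply, smul_eq_mul]; ring

/-- `hess` differentiates `df(w)` with `w` frozen; this form exposes the full second derivative and
hence linearity in both slots. -/
theorem hess_eq (hs : UniqueDiffWithinAt ℝ s y) {f : Coord m → ℝ}
    (hf : DifferentiableWithinAt ℝ (fderivWithin ℝ f s) s y) (v w : Coord m) :
    D.hess s f y v w = fderivWithin ℝ (fderivWithin ℝ f s) s y v w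
      - fderivWithin ℝ f s y (D.christoffel s y v w) := by
  have := (hf.hasFDerivWithinAt.clm_apply (hasFDerivWithinAt_const w y s)).fderivWithin hs
  rw [hess, this]
  simp

end ChartData

/-! ### Gauss formula on the slice and the harmonic gauge condition -/

namespace AdaptedSlice

variable {k : ℕ} {D : ChartData (k + 1)} {s : Set (Coord (k + 1))} {φ : Coord k → Coord (k + 1)}
  {x₀ : Coord k} {g : Matrix (Fin k) (Fin k) ℝ}

theorem symm_second (H : AdaptedSlice D s φ x₀) (v w : Coord k) :
    fderiv ℝ (fderiv ℝ φ) x₀ v w = fderiv ℝ (fderiv ℝ φ) x₀ w v :=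
  H.smooth.isSymmSndFDerivAt (by simp) v w

/-- Differentiate `ℓ(∂_w φ) = 0` along the slice. By symmetry of `∂²φ`, the derivative of `ℓ` is
then symmetric on tangent vectors, that is, `F` vanishes there. -/
theorem ell_second (H : AdaptedSlice D s φ x₀) (v w : Coord k) :
    D.ℓ (φ x₀) (fderiv ℝ (fderiv ℝ φ) x₀ v w)
      = - fderivWithin ℝ D.ℓ s (φ x₀) (fderiv ℝ φ x₀ v) (fderiv ℝ φ x₀ w) := by
  have h1 := (hasFDerivAt_covec_comp H.smooth H.mem H.diff_ℓ w).fderiv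
  have h2 : (fun x => D.ℓ (φ x) (fderiv ℝ φ x w)) =ᶠ[𝓝 x₀] fun _ => 0 :=
    H.ℓ_tangent.mono fun x hx => hx w
  rw [h2.fderiv_eq] at h1
  have h3 := congrArg (fun L : Coord k →L[ℝ] ℝ => L v) h1
  simp at h3
  linarith

theorem isLinearMap_metricDeriv (v w : Coord (k + 1)) : IsLinearMap ℝ fun z =>
    (1 / 2) * (fderivWithin ℝ D.γ s (φ x₀) v w z + fderivWithin ℝ D.γ s (φ x₀) w v z
      - fderivWithin ℝ D.γ s (φ x₀) z v w) where
  map_add z z' := by simp; ring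
  map_smul c z := by simp; ring

theorem apply_christoffel (H : AdaptedSlice D s φ x₀)
    (hg : g * gram (inducedMetric D φ x₀) = 1) (v w : Coord (k + 1)) (β : Coord (k + 1) →L[ℝ] ℝ) :
    β (D.christoffel s (φ x₀) v w) = ∑ i, ∑ j, g i j *
      ((1 / 2) * (fderivWithin ℝ D.γ s (φ x₀) v w (fderiv ℝ φ x₀ (basisVec i))
        + fderivWithin ℝ D.γ s (φ x₀) w v (fderiv ℝ φ x₀ (basisVec i))
        - fderivWithin ℝ D.γ s (φ x₀) (fderiv ℝ φ x₀ (basisVec i)) v w)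
        * β (fderiv ℝ φ x₀ (basisVec j)))
      + ((1 / 2) * (fderivWithin ℝ D.ℓ s (φ x₀) v w + fderivWithin ℝ D.ℓ s (φ x₀) w v)
        - D.Y (φ x₀) v w) * β (D.n (φ x₀)) := by
  rw [ChartData.christoffel, map_add, H.apply_raise hg (isLinearMap_metricDeriv v w), map_smul,
    smul_eq_mul]

/-- `∇̄ ℓ = Y + F` where `ℓ⁽²⁾ = 0`. -/
theorem covEll_eq (H : AdaptedSlice D s φ x₀) (hg : g * gram (inducedMetric D φ x₀) = 1)
    (v w : Coord (k + 1)) :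
    D.covEll s (φ x₀) v w = D.Y (φ x₀) v w + D.F s (φ x₀) v w := by
  rw [ChartData.covEll, H.apply_christoffel hg, ChartData.F, H.ell_n]
  simp only [H.ell_tangent, mul_zero, Finset.sum_const_zero]
  ring

/-- `(∇̄_n ℓ)(X) = Π(X, n) + (ℒ_n ℓ)(X)`. -/
theorem covEll_n (H : AdaptedSlice D s φ x₀) (hg : g * gram (inducedMetric D φ x₀) = 1)
    (X : Coord (k + 1)) :
    D.covEll s (φ x₀) (D.n (φ x₀)) X
      = D.Pi s (φ x₀) X (D.n (φ x₀)) + D.lieNell s (φ x₀) X := by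
  -- Differentiating `ℓ(n) = 1` along `X` gives `(∂_X ℓ)(n) = -ℓ(∂_X n)`, which identifies `2F(n,
  -- X)` with `(ℒ_n ℓ)(X)`.
  have h1 := (H.diff_ℓ.hasFDerivWithinAt.clm_apply H.diff_n.hasFDerivWithinAt).fderivWithin
    (H.uniq _ H.mem_self)
  have h2 : (fun y => D.ℓ y (D.n y)) =ᶠ[𝓝[s] (φ x₀)] fun _ => 1 := H.ℓ_n
  rw [h2.fderivWithin_eq (H.ell_n), fderivWithin_const_apply] at h1
  have h3 := congrArg (fun L : Coord (k + 1) →L[ℝ] ℝ => L X) h1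
  simp at h3
  rw [H.covEll_eq hg, ChartData.Pi, ChartData.lieNell, ChartData.F, ChartData.F, H.symm_Y]
  linarith

theorem fderiv_inducedMetric (H : AdaptedSlice D s φ x₀) (v w u : Coord k) :
    fderiv ℝ (fun x => inducedMetric D φ x w u) x₀ v
      = fderivWithin ℝ D.γ s (φ x₀) (fderiv ℝ φ x₀ v) (fderiv ℝ φ x₀ w) (fderiv ℝ φ x₀ u)
        + D.γ (φ x₀) (fderiv ℝ (fderiv ℝ φ) x₀ v w) (fderiv ℝ φ x₀ u)
        + D.γ (φ x₀) (fderiv ℝ φ x₀ w) (fderiv ℝ (fderiv ℝ φ) x₀ v u) := by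
  have h1 := hasFDerivAt_covec_comp H.smooth H.mem H.diff_γ w
  have h3 : HasFDerivAt (fderiv ℝ φ) (fderiv ℝ (fderiv ℝ φ) x₀) x₀ :=
    ((H.smooth.fderiv_right (m := 1) (by norm_num)).differentiableAt (by norm_num)).hasFDerivAt
  have h4 := (h1.clm_apply (h3.clm_apply (hasFDerivAt_const u x₀))).fderiv
  simp only [inducedMetric]
  rw [h4]
  simp
  ring

/-- The Christoffel symbols of the induced metric, in terms of `γ` and `φ`. -/
theorem koszul_eq (H : AdaptedSlice D s φ x₀) (v w u : Coord k) :
    koszul (inducedMetric D φ) x₀ v w u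
      = D.γ (φ x₀) (fderiv ℝ (fderiv ℝ φ) x₀ v w) (fderiv ℝ φ x₀ u)
        + (1 / 2) * (fderivWithin ℝ D.γ s (φ x₀) (fderiv ℝ φ x₀ v) (fderiv ℝ φ x₀ w)
            (fderiv ℝ φ x₀ u)
          + fderivWithin ℝ D.γ s (φ x₀) (fderiv ℝ φ x₀ w) (fderiv ℝ φ x₀ v) (fderiv ℝ φ x₀ u)
          - fderivWithin ℝ D.γ s (φ x₀) (fderiv ℝ φ x₀ u) (fderiv ℝ φ x₀ v)
            (fderiv ℝ φ x₀ w)) := by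
  rw [koszul, H.fderiv_inducedMetric, H.fderiv_inducedMetric, H.fderiv_inducedMetric,
    H.symm_second w v, H.symm_second u v, H.symm_second u w,
    H.symm_γ (fderiv ℝ φ x₀ w) _, H.symm_γ (fderiv ℝ φ x₀ v) _]
  ring

/-- The chain rule is needed on a whole neighbourhood of `x₀`, because the Hessian differentiates it
once more. -/
theorem fderiv_comp (H : AdaptedSlice D s φ x₀) {f : Coord (k + 1) → ℝ}
    (hf : ContDiffWithinAt ℝ 2 f s (φ x₀)) : ∀ᶠ x in 𝓝 x₀, ∀ w,
      fderiv ℝ (fun x' => f (φ x')) x w = fderivWithin ℝ f s (φ x) (fderiv ℝ φ x w) := by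
  have h1 : ∀ᶠ y in 𝓝[s] φ x₀, ContDiffWithinAt ℝ 2 f s y := by
    have := hf.eventually (by simp)
    rwa [insert_eq_of_mem H.mem_self] at this
  have h2 : Filter.Tendsto φ (𝓝 x₀) (𝓝[s] φ x₀) :=
    tendsto_nhdsWithin_iff.2 ⟨H.smooth.continuousAt, H.mem⟩
  filter_upwards [h2.eventually h1, H.smooth.eventually (by simp), H.mem.eventually_nhds]
    with x hx hφ hm w
  have h3 := (hx.differentiableWithinAt (by norm_num)).hasFDerivWithinAt.comp_hasFDerivAt x
    (hφ.differentiableAt (by norm_num)).hasFDerivAt hm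
  have h4 : (fun x' => f (φ x')) = f ∘ φ := rfl
  rw [h4, h3.fderiv]
  rfl

/-- The Hessian of `f` on tangent vectors of the slice. -/
theorem hess_tangent (H : AdaptedSlice D s φ x₀) (hg : g * gram (inducedMetric D φ x₀) = 1)
    {f : Coord (k + 1) → ℝ} (hf : ContDiffWithinAt ℝ 2 f s (φ x₀)) (v w : Coord k) :
    D.hess s f (φ x₀) (fderiv ℝ φ x₀ v) (fderiv ℝ φ x₀ w)
      = fderiv ℝ (fun x => fderiv ℝ (fun x' => f (φ x')) x w) x₀ v
        - ∑ i, ∑ j, g i j * (koszul (inducedMetric D φ) x₀ v w (basisVec i)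
          * fderiv ℝ (fun x' => f (φ x')) x₀ (basisVec j))
        + fderivWithin ℝ f s (φ x₀) (D.n (φ x₀))
          * D.Y (φ x₀) (fderiv ℝ φ x₀ v) (fderiv ℝ φ x₀ w) := by
  have hdf : DifferentiableWithinAt ℝ (fderivWithin ℝ f s) s (φ x₀) :=
    (hf.fderivWithin_right (m := 1) H.uniq (by norm_num) H.mem_self).differentiableWithinAt
      (by norm_num)
  have h1 := H.fderiv_comp hf
  have h2 := (hasFDerivAt_covec_comp H.smooth H.mem hdf w).fderiv
  have h3 : (fun x => fderiv ℝ (fun x' => f (φ x')) x w)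
      =ᶠ[𝓝 x₀] fun x => fderivWithin ℝ f s (φ x) (fderiv ℝ φ x w) := h1.mono fun x hx => hx w
  rw [h3.fderiv_eq, h2, D.hess_eq s _ (H.uniq _ H.mem_self) hdf, H.apply_christoffel hg]
  simp only [h1.self_of_nhds, H.koszul_eq, add_mul, mul_add, Finset.sum_add_distrib]
  -- Splitting `∂²φ`: its tangential part completes the derivatives of `γ` to the Christoffel
  -- symbols of the induced metric, and its `n`-part is `-(∂_v ℓ)(w)`.
  have h4 := congrArg (fderivWithin ℝ f s (φ x₀)) (H.decomp hg (fderiv ℝ (fderiv ℝ φ) x₀ v w))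
  simp only [map_add, map_sum, map_smul, smul_eq_mul, H.ell_second] at h4
  have h5 := H.ell_second v w
  rw [H.symm_second, H.ell_second] at h5
  simp only [add_apply, ContinuousLinearMap.flip_apply, ContinuousLinearMap.comp_apply, h4,
    mul_assoc]
  -- With this symmetry the `n`-component of the connection is `(∂_v ℓ)(w) - Y(v, w)`. Its
  -- `ℓ`-derivative cancels against that of `∂²φ`, and only `n(f) Y` remains.
  have h6 : fderivWithin ℝ D.ℓ s (φ x₀) (fderiv ℝ φ x₀ w) (fderiv ℝ φ x₀ v)
    = fderivWithin ℝ D.ℓ s (φ x₀) (fderiv ℝ φ x₀ v) (fderiv ℝ φ x₀ w) := by linarith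
  rw [h6]
  ring

theorem boxP_eq (H : AdaptedSlice D s φ x₀) (hg : g * gram (inducedMetric D φ x₀) = 1)
    {f : Coord (k + 1) → ℝ} (hf : ContDiffWithinAt ℝ 2 f s (φ x₀)) :
    D.boxP s f (φ x₀) = ∑ i, ∑ j, g i j *
      D.hess s f (φ x₀) (fderiv ℝ φ x₀ (basisVec i)) (fderiv ℝ φ x₀ (basisVec j)) := by
  have hdf : DifferentiableWithinAt ℝ (fderivWithin ℝ f s) s (φ x₀) :=
    (hf.fderivWithin_right (m := 1) H.uniq (by norm_num) H.mem_self).differentiableWithinAt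
      (by norm_num)
  refine H.trP_eq_sum hg (fun v => ⟨fun w w' => ?_, fun c w => ?_⟩)
    (fun w => ⟨fun v v' => ?_, fun c v => ?_⟩) <;>
  simp only [D.hess_eq s _ (H.uniq _ H.mem_self) hdf,
    (D.isLinearMap_christoffel_right s (φ x₀) _).map_add,
    (D.isLinearMap_christoffel_right s (φ x₀) _).map_smul,
    (D.isLinearMap_christoffel_left s (φ x₀) _).map_add,
    (D.isLinearMap_christoffel_left s (φ x₀) _).map_smul, map_add, map_smul, add_apply,
    smul_apply, smul_eq_mul] <;> ring

theorem apply_harmonicVec (H : AdaptedSlice D s φ x₀) (hg : g * gram (inducedMetric D φ x₀) = 1)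
    (β : Coord (k + 1) →L[ℝ] ℝ) :
    β (D.harmonicVec s (φ x₀)) = 2 * ∑ i, ∑ j, g i j *
        (D.covEll s (φ x₀) (D.n (φ x₀)) (fderiv ℝ φ x₀ (basisVec i))
          * β (fderiv ℝ φ x₀ (basisVec j)))
      + fderivWithin ℝ D.ℓ₂ s (φ x₀) (D.n (φ x₀)) * β (D.n (φ x₀)) := by
  rw [ChartData.harmonicVec, map_add, map_smul, map_smul,
    H.apply_raise hg (D.isLinearMap_covEll s _ _)]
  rfl

/-- The harmonic gauge condition for a function that is constant on the slice. -/
theorem n_ell₂_eq (H : AdaptedSlice D s φ x₀) (hg : g * gram (inducedMetric D φ x₀) = 1)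
    {f : Coord (k + 1) → ℝ} (hf : ContDiffWithinAt ℝ 2 f s (φ x₀))
    (hconst : ∃ c, (fun x => f (φ x)) =ᶠ[𝓝 x₀] fun _ => c)
    (hn : fderivWithin ℝ f s (φ x₀) (D.n (φ x₀)) ≠ 0)
    (hharm : fderivWithin ℝ f s (φ x₀) (D.harmonicVec s (φ x₀)) = D.boxP s f (φ x₀)) :
    fderivWithin ℝ D.ℓ₂ s (φ x₀) (D.n (φ x₀)) = ∑ i, ∑ j, g i j *
      D.Y (φ x₀) (fderiv ℝ φ x₀ (basisVec i)) (fderiv ℝ φ x₀ (basisVec j)) := by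
  obtain ⟨c, hc⟩ := hconst
  -- The derivative vanishes near `x₀`, not only at it, so the intrinsic Hessian of `f ∘ φ` vanishes
  -- too.
  have h1 : ∀ᶠ x in 𝓝 x₀, fderiv ℝ (fun x' => f (φ x')) x = 0 := by
    filter_upwards [hc.eventually_nhds] with x hx
    have : (fun x => f (φ x)) =ᶠ[𝓝 x] fun _ => c := hx
    rw [this.fderiv_eq, fderiv_fun_const]
    rfl
  have h2 : ∀ w, (fun x => fderiv ℝ (fun x' => f (φ x')) x w) =ᶠ[𝓝 x₀] fun _ => 0 := fun w =>
    h1.mono fun x hx => by simp [hx]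
  rw [H.apply_harmonicVec hg, H.boxP_eq hg hf] at hharm
  simp only [H.hess_tangent hg hf, ← (H.fderiv_comp hf).self_of_nhds, h1.self_of_nhds,
    (h2 _).fderiv_eq] at hharm
  simp only [fderiv_fun_const, Pi.zero_apply, zero_apply, mul_zero,
    Finset.sum_const_zero, zero_add, sub_zero, mul_left_comm (g _ _), ← Finset.mul_sum] at hharm
  -- Both sides have become multiples of `n(f)`.
  refine mul_right_cancel₀ hn ?_
  rw [hharm, mul_comm]

/-- The harmonic gauge condition expresses `P(∇̄_n ℓ, df)` by the geometry of the slice. -/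
theorem harmonic_tangent (H : AdaptedSlice D s φ x₀) (hg : g * gram (inducedMetric D φ x₀) = 1)
    {f : Coord (k + 1) → ℝ} (hf : ContDiffWithinAt ℝ 2 f s (φ x₀))
    (hY : fderivWithin ℝ D.ℓ₂ s (φ x₀) (D.n (φ x₀)) = ∑ i, ∑ j, g i j *
      D.Y (φ x₀) (fderiv ℝ φ x₀ (basisVec i)) (fderiv ℝ φ x₀ (basisVec j)))
    (hharm : fderivWithin ℝ f s (φ x₀) (D.harmonicVec s (φ x₀)) = D.boxP s f (φ x₀)) :
    2 * ∑ i, ∑ j, g i j *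
        (D.covEll s (φ x₀) (D.n (φ x₀)) (fderiv ℝ φ x₀ (basisVec i))
          * fderiv ℝ (fun x' => f (φ x')) x₀ (basisVec j))
      = ∑ i, ∑ j, g i j *
        (fderiv ℝ (fun x => fderiv ℝ (fun x' => f (φ x')) x (basisVec j)) x₀ (basisVec i)
        - ∑ l, ∑ m, g l m * (koszul (inducedMetric D φ) x₀ (basisVec i) (basisVec j) (basisVec l)
          * fderiv ℝ (fun x' => f (φ x')) x₀ (basisVec m))) := by
  rw [H.apply_harmonicVec hg, H.boxP_eq hg hf, hY] at hharm
  simp only [H.hess_tangent hg hf, ← (H.fderiv_comp hf).self_of_nhds, mul_add,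
    Finset.sum_add_distrib] at hharm
  have h1 : ∑ i, ∑ j, g i j * (fderivWithin ℝ f s (φ x₀) (D.n (φ x₀)) *
      D.Y (φ x₀) (fderiv ℝ φ x₀ (basisVec i)) (fderiv ℝ φ x₀ (basisVec j)))
      = (∑ i, ∑ j, g i j *
      D.Y (φ x₀) (fderiv ℝ φ x₀ (basisVec i)) (fderiv ℝ φ x₀ (basisVec j)))
        * fderivWithin ℝ f s (φ x₀) (D.n (φ x₀)) := by
    simp only [Finset.sum_mul]
    exact Finset.sum_congr rfl fun i _ => Finset.sum_congr rfl fun j _ => by ring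
  -- By `hY` the terms with `n(f)` now agree on both sides and drop out.
  rw [h1] at hharm
  exact add_right_cancel hharm

end AdaptedSlice

/-! ### From charts to the manifold -/

section ManifoldLemmas

variable {k : ℕ} {H : Type*} [TopologicalSpace H] [ChartedSpace (EuclideanHalfSpace (k + 1)) H]

theorem mvfderiv_eq_fderivWithin {f : H → ℝ} {p : H}
    (hf : MDifferentiableAt (𝓡∂ (k + 1)) 𝓘(ℝ, ℝ) f p) (v : TangentSpace (𝓡∂ (k + 1)) p) :
    mvfderiv (𝓡∂ (k + 1)) f p v
      = fderivWithin ℝ (fun y => f ((extChartAt (𝓡∂ (k + 1)) p).symm y)) (halfSpace k)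
        (extChartAt (𝓡∂ (k + 1)) p p) v := by
  exact congrArg (fun L : Coord (k + 1) →L[ℝ] ℝ => L v) hf.mfderiv

theorem contDiffWithinAt_inChart {f : H → ℝ} {p : H} {N : WithTop ℕ∞}
    (hf : ContMDiffAt (𝓡∂ (k + 1)) 𝓘(ℝ, ℝ) N f p) :
    ContDiffWithinAt ℝ N (fun y => f ((extChartAt (𝓡∂ (k + 1)) p).symm y)) (halfSpace k)
      (extChartAt (𝓡∂ (k + 1)) p p) :=
  (contMDiffAt_iff.1 hf).2

theorem uniqueDiffOn_halfSpace : UniqueDiffOn ℝ (halfSpace k) :=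
  (𝓡∂ (k + 1)).uniqueDiffOn

variable [IsManifold (𝓡∂ (k + 1)) ∞ H]

theorem chartFrame_isInvertible {p : H} {y : Coord (k + 1)}
    (hy : y ∈ (extChartAt (𝓡∂ (k + 1)) p).target) : (chartFrame p y).IsInvertible := by
  have : IsManifold (𝓡∂ (k + 1)) 1 H := IsManifold.of_le (n := ∞) (by norm_num)
  exact isInvertible_mfderivWithin_extChartAt_symm hy

/-- The tangent space at `p` is the model space by way of the preferred chart at `p`, so at its own
base point the frame is the identity. -/
theorem chartFrame_self (p : H) (v : Coord (k + 1)) :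
    (chartFrame p (extChartAt (𝓡∂ (k + 1)) p p) v : Coord (k + 1)) = v := by
  have : IsManifold (𝓡∂ (k + 1)) 1 H := IsManifold.of_le (n := ∞) (by norm_num)
  have h := mfderivWithin_range_extChartAt_symm (I := 𝓡∂ (k + 1)) (x := p)
  exact congrArg (fun L : Coord (k + 1) →L[ℝ] Coord (k + 1) => L v) h

theorem tensorInChart_self
    (T : ∀ p : H, TangentSpace (𝓡∂ (k + 1)) p →L[ℝ] TangentSpace (𝓡∂ (k + 1)) p →L[ℝ] ℝ)
    (p : H) (v w : Coord (k + 1)) :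
    tensorInChart T p (extChartAt (𝓡∂ (k + 1)) p p) v w = T p v w := by
  -- Forgetting the dependence of the tangent space on the point allows the base point to be
  -- rewritten.
  let T' : H → Coord (k + 1) →L[ℝ] Coord (k + 1) →L[ℝ] ℝ := T
  have h : T' ((extChartAt (𝓡∂ (k + 1)) p).symm (extChartAt (𝓡∂ (k + 1)) p p)) = T' p := by
    rw [extChartAt_to_inv]
  calc tensorInChart T p (extChartAt (𝓡∂ (k + 1)) p p) v w
      = T' ((extChartAt (𝓡∂ (k + 1)) p).symm (extChartAt (𝓡∂ (k + 1)) p p))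
        (chartFrame p (extChartAt (𝓡∂ (k + 1)) p p) v)
        (chartFrame p (extChartAt (𝓡∂ (k + 1)) p p) w) := rfl
    _ = T p v w := by
        rw [h]
        exact congrArg₂ (fun a b => T' p a b) (chartFrame_self p v) (chartFrame_self p w)

namespace HypersurfaceData

variable {D : HypersurfaceData k H} {p : H} {y : Coord (k + 1)}

theorem IsHypersurfaceData.invertible_inChart (hD : D.IsHypersurfaceData)
    (hy : y ∈ (extChartAt (𝓡∂ (k + 1)) p).target) :
    (ambientForm ((D.inChart p).γ y) ((D.inChart p).ℓ y) ((D.inChart p).ℓ₂ y)).IsInvertible := by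
  have hc := chartFrame_isInvertible hy
  refine ambientForm_isInvertible fun W a h => ?_
  have h1 := hD.nondeg ((extChartAt (𝓡∂ (k + 1)) p).symm y) (chartFrame p y W) a fun Z b => by
    obtain ⟨Z', rfl⟩ := hc.surjective Z
    exact h Z' b
  exact ⟨hc.injective (h1.1.trans (map_zero _).symm), h1.2⟩

theorem IsCHD.n₂_inChart (hD : D.IsCHD) (hy : y ∈ (extChartAt (𝓡∂ (k + 1)) p).target) :
    (D.inChart p).n₂ y = 0 := by
  obtain ⟨X, hX, hrad⟩ := hD.rad_ne ((extChartAt (𝓡∂ (k + 1)) p).symm y)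
  obtain ⟨X', rfl⟩ := (chartFrame_isInvertible hy).surjective X
  refine nScal_eq_zero (X := X') (hD.toIsHypersurfaceData.invertible_inChart hy)
    (fun v w => hD.symm_γ _ _ _) (fun h => hX ?_) (fun Z => hrad _)
  rw [h, map_zero]

theorem IsHypersurfaceData.contDiffWithinAt_n (hD : D.IsHypersurfaceData) :
    ContDiffWithinAt ℝ ∞ (D.inChart p).n (halfSpace k) (extChartAt (𝓡∂ (k + 1)) p p) := by
  have hn : (extChartAt (𝓡∂ (k + 1)) p).target ∈ 𝓝[halfSpace k] (extChartAt (𝓡∂ (k + 1)) p p) :=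
    extChartAt_target_mem_nhdsWithin p
  have hm := mem_extChartAt_target (I := 𝓡∂ (k + 1)) p
  exact contDiffWithinAt_nVec ((hD.smooth_γ p _ hm).mono_of_mem_nhdsWithin hn)
    ((hD.smooth_ℓ p _ hm).mono_of_mem_nhdsWithin hn)
    (contDiffWithinAt_inChart (hD.smooth_ℓ₂ p)) (hD.invertible_inChart hm)

end HypersurfaceData

end ManifoldLemmas

/-! ### The boundary embedding in preferred charts -/

section Slice

variable {k : ℕ} {S : Type*} [TopologicalSpace S] [ChartedSpace (EuclideanSpace ℝ (Fin k)) S]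
  {H : Type*} [TopologicalSpace H] [ChartedSpace (EuclideanHalfSpace (k + 1)) H]

/-- The coordinate expression of `i : S → H` near `s`. -/
noncomputable def sliceMap (i : S → H) (s : S) (x : Coord k) : Coord (k + 1) :=
  extChartAt (𝓡∂ (k + 1)) (i s) (i ((extChartAt (𝓡 k) s).symm x))

/-- The differential at `x` of the inverse of the preferred chart of `S` at `s`. -/
noncomputable def sliceFrame (s : S) (x : Coord k) :
    Coord k →L[ℝ] TangentSpace (𝓡 k) ((extChartAt (𝓡 k) s).symm x) :=
  mfderiv 𝓘(ℝ, Coord k) (𝓡 k) (extChartAt (𝓡 k) s).symm x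

theorem sliceMap_self (i : S → H) (s : S) :
    sliceMap i s (extChartAt (𝓡 k) s s) = extChartAt (𝓡∂ (k + 1)) (i s) (i s) := by
  rw [sliceMap, extChartAt_to_inv]

variable {i : S → H}

theorem contDiffAt_sliceMap (hi : ContMDiff (𝓡 k) (𝓡∂ (k + 1)) ∞ i) (s : S) :
    ContDiffAt ℝ ∞ (sliceMap i s) (extChartAt (𝓡 k) s s) := by
  have := (contMDiffAt_iff.1 (hi s)).2
  rw [(𝓡 k).range_eq_univ] at this
  exact this.contDiffAt Filter.univ_mem

theorem fderiv_sliceMap_self (hi : ContMDiff (𝓡 k) (𝓡∂ (k + 1)) ∞ i) (s : S) (v : Coord k) :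
    fderiv ℝ (sliceMap i s) (extChartAt (𝓡 k) s s) v = push i s v := by
  have h := ((hi s).mdifferentiableAt (by simp)).mfderiv
  rw [(𝓡 k).range_eq_univ, fderivWithin_univ] at h
  exact congrArg (fun L : Coord k →L[ℝ] Coord (k + 1) => L v) h.symm

theorem eventually_sliceMap (hi : Continuous i) (s : S) :
    ∀ᶠ x in 𝓝 (extChartAt (𝓡 k) s s), x ∈ (extChartAt (𝓡 k) s).target ∧
      i ((extChartAt (𝓡 k) s).symm x) ∈ (extChartAt (𝓡∂ (k + 1)) (i s)).source := by
  refine Filter.Eventually.and (extChartAt_target_mem_nhds s) ?_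
  have hc := hi.continuousAt.comp (continuousAt_extChartAt_symm (I := 𝓡 k) s)
  refine hc.eventually ?_
  rw [comp_apply, extChartAt_to_inv]
  exact extChartAt_source_mem_nhds (i s)

variable [IsManifold (𝓡 k) ∞ S] [IsManifold (𝓡∂ (k + 1)) ∞ H]

/-- The chain rule for `i`, in the preferred charts. -/
theorem chartFrame_comp_fderiv (hi : ContMDiff (𝓡 k) (𝓡∂ (k + 1)) ∞ i) (s : S) :
    ∀ᶠ x in 𝓝 (extChartAt (𝓡 k) s s), ∀ v : Coord k,
      (chartFrame (i s) (sliceMap i s x) (fderiv ℝ (sliceMap i s) x v) : Coord (k + 1))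
        = push i ((extChartAt (𝓡 k) s).symm x) (sliceFrame s x v) := by
  have : IsManifold (𝓡∂ (k + 1)) 1 H := IsManifold.of_le (n := ∞) (by norm_num)
  have : IsManifold (𝓡 k) 1 S := IsManifold.of_le (n := ∞) (by norm_num)
  have hev := eventually_sliceMap (k := k) (H := H) hi.continuous s
  have hsm := ((contDiffAt_sliceMap hi s).of_le (m := 1) (by norm_num)).eventually (by simp)
  filter_upwards [hev, hev.eventually_nhds, hsm] with x hx hxe hφ v
  have h1 : HasMFDerivAt 𝓘(ℝ, Coord k) (𝓡 k) (extChartAt (𝓡 k) s).symm x (sliceFrame s x) := by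
    have := mdifferentiableWithinAt_extChartAt_symm (I := 𝓡 k) hx.1
    rw [(𝓡 k).range_eq_univ, mdifferentiableWithinAt_univ] at this
    exact this.hasMFDerivAt
  have h2 := ((hi ((extChartAt (𝓡 k) s).symm x)).mdifferentiableAt (by simp)).hasMFDerivAt.comp x h1
  have h3 : HasMFDerivAt 𝓘(ℝ, Coord k) 𝓘(ℝ, Coord (k + 1)) (sliceMap i s) x
      (fderiv ℝ (sliceMap i s) x) :=
    (hφ.differentiableAt (by norm_num)).hasFDerivAt.hasMFDerivAt
  have h4 : HasMFDerivWithinAt 𝓘(ℝ, Coord (k + 1)) (𝓡∂ (k + 1)) (extChartAt (𝓡∂ (k + 1)) (i s)).symm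
      (halfSpace k) (sliceMap i s x) (chartFrame (i s) (sliceMap i s x)) :=
    (mdifferentiableWithinAt_extChartAt_symm
      ((extChartAt (𝓡∂ (k + 1)) (i s)).map_source hx.2)).hasMFDerivWithinAt
  have h5 := h4.comp x h3.hasMFDerivWithinAt (s := univ) fun x' _ => mem_range_self _
  rw [hasMFDerivWithinAt_univ] at h5
  have h6 : (fun x' => i ((extChartAt (𝓡 k) s).symm x'))
      =ᶠ[𝓝 x] (extChartAt (𝓡∂ (k + 1)) (i s)).symm ∘ sliceMap i s := by
    filter_upwards [hxe] with x' hx'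
    exact ((extChartAt (𝓡∂ (k + 1)) (i s)).left_inv hx'.2).symm
  have h7 := h5.congr_of_eventuallyEq h6
  exact congrArg (fun L : Coord k →L[ℝ] Coord (k + 1) => L v) (hasMFDerivAt_unique h7 h2)

/-- The right side involves only `γ` on push-forwards from `S`, so it can be compared between the
two hypersurfaces, whose charts are unrelated. -/
theorem inducedMetric_sliceMap (D : HypersurfaceData k H)
    (hi : ContMDiff (𝓡 k) (𝓡∂ (k + 1)) ∞ i) (s : S) :
    ∀ᶠ x in 𝓝 (extChartAt (𝓡 k) s s), ∀ v w,
      inducedMetric (D.inChart (i s)) (sliceMap i s) x v w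
        = D.γ (i ((extChartAt (𝓡 k) s).symm x))
          (push i _ (sliceFrame s x v)) (push i _ (sliceFrame s x w)) := by
  filter_upwards [chartFrame_comp_fderiv hi s, eventually_sliceMap (H := H) hi.continuous s]
    with x hx hx' v w
  let T : H → Coord (k + 1) →L[ℝ] Coord (k + 1) →L[ℝ] ℝ := D.γ
  have h : T ((extChartAt (𝓡∂ (k + 1)) (i s)).symm (sliceMap i s x))
      = T (i ((extChartAt (𝓡 k) s).symm x)) := by
    rw [sliceMap, (extChartAt (𝓡∂ (k + 1)) (i s)).left_inv hx'.2]
  calc _ = T ((extChartAt (𝓡∂ (k + 1)) (i s)).symm (sliceMap i s x))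
        (chartFrame (i s) (sliceMap i s x) (fderiv ℝ (sliceMap i s) x v))
        (chartFrame (i s) (sliceMap i s x) (fderiv ℝ (sliceMap i s) x w)) := rfl
    _ = _ := by
        rw [h]
        exact congrArg₂ (fun a b => T (i ((extChartAt (𝓡 k) s).symm x)) a b) (hx v) (hx w)

theorem ell_sliceMap (D : HypersurfaceData k H)
    (hi : ContMDiff (𝓡 k) (𝓡∂ (k + 1)) ∞ i) (s : S) :
    ∀ᶠ x in 𝓝 (extChartAt (𝓡 k) s s), ∀ v,
      (D.inChart (i s)).ℓ (sliceMap i s x) (fderiv ℝ (sliceMap i s) x v)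
        = D.ℓ (i ((extChartAt (𝓡 k) s).symm x)) (push i _ (sliceFrame s x v)) := by
  filter_upwards [chartFrame_comp_fderiv hi s, eventually_sliceMap (H := H) hi.continuous s]
    with x hx hx' v
  let T : H → Coord (k + 1) →L[ℝ] ℝ := D.ℓ
  have h : T ((extChartAt (𝓡∂ (k + 1)) (i s)).symm (sliceMap i s x))
      = T (i ((extChartAt (𝓡 k) s).symm x)) := by
    rw [sliceMap, (extChartAt (𝓡∂ (k + 1)) (i s)).left_inv hx'.2]
  calc _ = T ((extChartAt (𝓡∂ (k + 1)) (i s)).symm (sliceMap i s x))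
        (chartFrame (i s) (sliceMap i s x) (fderiv ℝ (sliceMap i s) x v)) := rfl
    _ = _ := by
        rw [h]
        exact congrArg (fun a => T (i ((extChartAt (𝓡 k) s).symm x)) a) (hx v)

/-- The image of an adapted map into characteristic data is an adapted slice. -/
theorem HypersurfaceData.IsCHD.adaptedSlice {D : HypersurfaceData k H} (hD : D.IsCHD)
    (hi : ContMDiff (𝓡 k) (𝓡∂ (k + 1)) ∞ i) (had : IsAdapted D i)
    (hpos : ∀ s X, X ≠ 0 → 0 < D.γ (i s) (push i s X) (push i s X)) (s : S) :
    AdaptedSlice (D.inChart (i s)) (halfSpace k) (sliceMap i s) (extChartAt (𝓡 k) s s) := by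
  have hn : (extChartAt (𝓡∂ (k + 1)) (i s)).target
      ∈ 𝓝[halfSpace k] (extChartAt (𝓡∂ (k + 1)) (i s) (i s)) :=
    extChartAt_target_mem_nhdsWithin _
  have hm := mem_extChartAt_target (I := 𝓡∂ (k + 1)) (i s)
  have hinv := hD.toIsHypersurfaceData.invertible_inChart hm
  have h0 := sliceMap_self (k := k) i s
  exact {
    uniq := uniqueDiffOn_halfSpace
    mem := Filter.Eventually.of_forall fun x => mem_range_self _
    smooth := contDiffAt_infty.1 (contDiffAt_sliceMap hi s) 2
    diff_γ := by
      rw [h0]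
      exact ((hD.smooth_γ _ _ hm).mono_of_mem_nhdsWithin hn).differentiableWithinAt (by norm_num)
    diff_ℓ := by
      rw [h0]
      exact ((hD.smooth_ℓ _ _ hm).mono_of_mem_nhdsWithin hn).differentiableWithinAt (by norm_num)
    diff_n := by
      rw [h0]
      exact hD.toIsHypersurfaceData.contDiffWithinAt_n.differentiableWithinAt (by norm_num)
    symm_γ := fun v w => hD.symm_γ _ _ _
    symm_Y := fun v w => hD.symm_Y _ _ _
    invertible := by rw [h0]; exact hinv
    γ_n := by rw [h0]; exact gamma_nVec hinv (hD.n₂_inChart hm)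
    ℓ_n := by
      rw [h0]
      -- Degeneracy holds throughout the chart, so `ℓ(n) = 1` does too and may be differentiated.
      filter_upwards [hn] with y hy
      exact ell_nVec (hD.toIsHypersurfaceData.invertible_inChart hy) (hD.n₂_inChart hy)
    ℓ₂_zero := by
      rw [h0]
      change D.ℓ₂ _ = 0
      rw [extChartAt_to_inv]
      exact had.2 s
    ℓ_tangent := by
      filter_upwards [ell_sliceMap D hi s] with x hx w
      rw [hx, had.1]
    pos := fun v hv => by
      rw [h0, fderiv_sliceMap_self hi]
      exact (hpos s v hv).trans_eq (tensorInChart_self D.γ (i s) _ _).symm }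

end Slice

/-! ### The trivial gauge transformation -/

theorem lieTensor_zero {m : ℕ} (s : Set (Coord m))
    (T : Coord m → Coord m →L[ℝ] Coord m →L[ℝ] ℝ) (y : Coord m) :
    lieTensor s (fun _ => 0) T y = 0 := by
  refine ContinuousLinearMap.ext fun v => ContinuousLinearMap.ext fun w => ?_
  simp only [lieTensor, fderivWithin_fun_const, add_apply, map_zero,
    ContinuousLinearMap.bilinearComp_apply, Pi.zero_apply, zero_apply, add_zero]

/-- The trivial gauge transformation. -/
theorem HypersurfaceData.gauge_one_zero {k : ℕ} {H : Type*} [TopologicalSpace H]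
    [ChartedSpace (EuclideanHalfSpace (k + 1)) H] (D : HypersurfaceData k H) :
    D.gauge (fun _ => 1) (fun _ => 0) = D := by
  have hz : ∀ p : H, mvfderiv (𝓡∂ (k + 1)) (fun _ : H => (1 : ℝ)) p = 0 := fun p => by
    simp [mvfderiv, mfderiv_const]
  have hv : ∀ p : H, vecInChart (fun q : H => (1 : ℝ) • (0 : TangentSpace (𝓡∂ (k + 1)) q)) p
      = fun _ => 0 := fun p => by
    ext1 y
    simp only [vecInChart, smul_zero, map_zero]
  have hl : ∀ p : H, lieDerivTensor (fun q : H => (1 : ℝ) • (0 : TangentSpace (𝓡∂ (k + 1)) q))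
      D.γ p = 0 := fun p => by
    rw [lieDerivTensor, hv]
    exact lieTensor_zero _ _ _
  cases D
  simp only [gauge, mk.injEq]
  refine ⟨trivial, ?_, ?_, ?_⟩
  · ext p v; simp
  · ext p; simp
  · ext p v w
    rw [hz, hl]
    simp

theorem isGaugeParam_one_zero {k : ℕ} {H : Type*} [TopologicalSpace H]
    [ChartedSpace (EuclideanHalfSpace (k + 1)) H] [IsManifold (𝓡∂ (k + 1)) ∞ H] :
    IsGaugeParam (k := k) (fun _ : H => (1 : ℝ)) (fun _ => 0) where
  smooth_z := contMDiff_const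
  ne_zero _ := one_ne_zero
  smooth_ζ := Bundle.contMDiff_zeroSection ℝ (TangentSpace (𝓡∂ (k + 1)) : H → Type _)

/-! ### The Laplacian of the boundary metric, and separation by covectors -/

/-- The `g`-trace of the second covariant derivative of `f` with respect to the metric `h`. -/
noncomputable def metricBox {k : ℕ} (g : Matrix (Fin k) (Fin k) ℝ)
    (h : Coord k → Coord k → Coord k → ℝ) (f : Coord k → ℝ) (x : Coord k) : ℝ :=
  ∑ i, ∑ j, g i j * (fderiv ℝ (fun x' => fderiv ℝ f x' (basisVec j)) x (basisVec i)
    - ∑ l, ∑ m, g l m * (koszul h x (basisVec i) (basisVec j) (basisVec l)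
      * fderiv ℝ f x (basisVec m)))

theorem koszul_congr {k : ℕ} {h h' : Coord k → Coord k → Coord k → ℝ} {x : Coord k}
    (e : ∀ᶠ x' in 𝓝 x, ∀ v w, h x' v w = h' x' v w) (v w u : Coord k) :
    koszul h x v w u = koszul h' x v w u := by
  have e' : ∀ v w, (fun x' => h x' v w) =ᶠ[𝓝 x] fun x' => h' x' v w := fun v w =>
    e.mono fun x' hx => hx v w
  simp only [koszul, (e' _ _).fderiv_eq]

/-- Agreement is required near `x`: the operator differentiates the metric once and the function
twice. -/
theorem metricBox_congr {k : ℕ} {g : Matrix (Fin k) (Fin k) ℝ}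
    {h h' : Coord k → Coord k → Coord k → ℝ} {f f' : Coord k → ℝ} {x : Coord k}
    (e : ∀ᶠ x' in 𝓝 x, ∀ v w, h x' v w = h' x' v w) (ef : f =ᶠ[𝓝 x] f') :
    metricBox g h f x = metricBox g h' f' x := by
  have e' : ∀ w, (fun x' => fderiv ℝ f x' w) =ᶠ[𝓝 x] fun x' => fderiv ℝ f' x' w := fun w =>
    (ef.fderiv (𝕜 := ℝ)).mono fun x' hx => congrArg (fun L : Coord k →L[ℝ] ℝ => L w) hx
  simp only [metricBox, (e' _).fderiv_eq, ef.fderiv_eq, koszul_congr e]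

/-- As many independent covectors as the dimension span the dual, and the dual separates points. -/
theorem eq_zero_of_linearIndependent {m : ℕ} {β : Fin m → Coord m →L[ℝ] ℝ}
    (hβ : LinearIndependent ℝ β) {X : Coord m} (hX : ∀ a, β a X = 0) : X = 0 := by
  have hli := hβ.map' (ContinuousLinearMap.coeLM ℝ) (LinearMap.ker_eq_bot.2
    ContinuousLinearMap.coe_injective)
  have hspan := hli.span_eq_top_of_card_eq_finrank' (by
    have := Subspace.dual_finrank_eq (K := ℝ) (V := Coord m)
    rw [finrank_euclideanSpace] at this
    exact this.symm)
  refine (Module.forall_dual_apply_eq_zero_iff ℝ X).1 fun α => ?_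
  have hα : α ∈ Submodule.span ℝ (range (ContinuousLinearMap.coeLM ℝ ∘ β)) :=
    hspan.symm ▸ Submodule.mem_top
  induction hα using Submodule.span_induction with
  | mem α hα => obtain ⟨a, rfl⟩ := hα; exact hX a
  | zero => rfl
  | add α α' _ _ h1 h2 => rw [LinearMap.add_apply, h1, h2, add_zero]
  | smul c α _ h1 => rw [LinearMap.smul_apply, h1, smul_zero]

/-! ### Boundary identities for one of the two data -/

section OneSide

variable {k : ℕ} {S : Type*} [TopologicalSpace S] [ChartedSpace (EuclideanSpace ℝ (Fin k)) S]
  {H : Type*} [TopologicalSpace H] [ChartedSpace (EuclideanHalfSpace (k + 1)) H]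

/-- The metric induced on `S`, in the preferred chart at `s`. -/
noncomputable def sliceMetric (D : HypersurfaceData k H) (i : S → H) (s : S) (x v w : Coord k) :
    ℝ :=
  D.γ (i ((extChartAt (𝓡 k) s).symm x)) (push i _ (sliceFrame s x v)) (push i _ (sliceFrame s x w))

/-- The one-form `∇̄_n ℓ`. -/
noncomputable def HypersurfaceData.nablaNEll (D : HypersurfaceData k H) (p : H)
    (w : TangentSpace (𝓡∂ (k + 1)) p) : ℝ :=
  (D.inChart p).covEll (halfSpace k) (extChartAt (𝓡∂ (k + 1)) p p) (D.n p) w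

theorem sliceMap_comp {i : S → H} (hi : Continuous i) (s : S) (f : H → ℝ) :
    (fun x => f ((extChartAt (𝓡∂ (k + 1)) (i s)).symm (sliceMap i s x)))
      =ᶠ[𝓝 (extChartAt (𝓡 k) s s)] fun x => f (i ((extChartAt (𝓡 k) s).symm x)) := by
  filter_upwards [eventually_sliceMap (H := H) hi s] with x hx
  rw [sliceMap, (extChartAt (𝓡∂ (k + 1)) (i s)).left_inv hx.2]

theorem isLinearMap_nablaNEll (D : HypersurfaceData k H) (i : S → H) (s : S) :
    IsLinearMap ℝ fun v : Coord k => D.nablaNEll (i s) (push i s v) where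
  map_add v w := (congrArg (D.nablaNEll (i s))
    (map_add (mfderiv (𝓡 k) (𝓡∂ (k + 1)) i s) v w)).trans
      (((D.inChart (i s)).isLinearMap_covEll (halfSpace k) _ (D.n (i s))).map_add _ _)
  map_smul c v := (congrArg (D.nablaNEll (i s))
    (map_smul (mfderiv (𝓡 k) (𝓡∂ (k + 1)) i s) c v)).trans
      (((D.inChart (i s)).isLinearMap_covEll (halfSpace k) _ (D.n (i s))).map_smul c _)


variable {i : S → H} {D : HypersurfaceData k H} {g : Matrix (Fin k) (Fin k) ℝ} {s : S}

theorem fderiv_slice (hi : ContMDiff (𝓡 k) (𝓡∂ (k + 1)) ∞ i) {f : H → ℝ}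
    (hf : MDifferentiableAt (𝓡∂ (k + 1)) 𝓘(ℝ, ℝ) f (i s)) (v : Coord k) :
    fderiv ℝ (fun x => f (i ((extChartAt (𝓡 k) s).symm x))) (extChartAt (𝓡 k) s s) v
      = mvfderiv (𝓡∂ (k + 1)) f (i s) (push i s v) := by
  rw [mvfderiv_eq_fderivWithin hf, ← (sliceMap_comp hi.continuous s f).fderiv_eq,
    ← fderiv_sliceMap_self hi, ← sliceMap_self i s]
  have h1 : DifferentiableWithinAt ℝ (fun y => f ((extChartAt (𝓡∂ (k + 1)) (i s)).symm y))
      (halfSpace k) (sliceMap i s (extChartAt (𝓡 k) s s)) := by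
    rw [sliceMap_self]
    exact (mdifferentiableAt_iff _ _).1 hf |>.2
  have h2 := h1.hasFDerivWithinAt.comp_hasFDerivAt _
    ((contDiffAt_sliceMap hi s).differentiableAt (by norm_num)).hasFDerivAt
    (Filter.Eventually.of_forall fun x => mem_range_self _)
  exact congrArg (fun L : Coord k →L[ℝ] ℝ => L v) h2.fderiv

/-- A tangent vector of the boundary on which the differentials of independent functions vanish,
one of them constant on the boundary, is zero. -/
theorem eq_zero_of_independent (hi : ContMDiff (𝓡 k) (𝓡∂ (k + 1)) ∞ i)
    (hpos : ∀ s X, X ≠ 0 → 0 < D.γ (i s) (push i s X) (push i s X))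
    {U : Set H} (hU : IsOpen U) {u : H → ℝ} {x : Fin k → H → ℝ}
    (hx : IsIndependentOn (Fin.cons u x : Fin (k + 1) → H → ℝ) U) (hs : i s ∈ U)
    (hconst : ∀ s t, u (i s) = u (i t)) {v : Coord k}
    (hv : ∀ a, fderiv ℝ (fun y => x a (i ((extChartAt (𝓡 k) s).symm y)))
      (extChartAt (𝓡 k) s s) v = 0) : v = 0 := by
  have hd : ∀ a, MDifferentiableAt (𝓡∂ (k + 1)) 𝓘(ℝ, ℝ)
      ((Fin.cons u x : Fin (k + 1) → H → ℝ) a) (i s) := fun a =>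
    ((hx.smooth a).contMDiffAt (hU.mem_nhds hs)).mdifferentiableAt (by simp)
  have h0 : ∀ a, mvfderiv (𝓡∂ (k + 1)) ((Fin.cons u x : Fin (k + 1) → H → ℝ) a) (i s)
      (push i s v) = 0 := by
    intro a
    rw [← fderiv_slice hi (hd a)]
    refine Fin.cases ?_ (fun a => ?_) a
    · have : (fun y => (Fin.cons u x : Fin (k + 1) → H → ℝ) 0 (i ((extChartAt (𝓡 k) s).symm y)))
          = fun _ => u (i s) := funext fun y => hconst _ _
      rw [this]
      simp
    · exact hv a
  by_contra hne
  -- Positivity of the induced metric makes the push-forward injective.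
  have hX : (push i s v : Coord (k + 1)) ≠ 0 := fun h => by
    have h1 := hpos s v hne
    have h2 : push i s v = 0 := h
    rw [h2, map_zero] at h1
    exact lt_irrefl _ h1
  exact hX (eq_zero_of_linearIndependent (β := fun a =>
    mvfderiv (𝓡∂ (k + 1)) ((Fin.cons u x : Fin (k + 1) → H → ℝ) a) (i s)) (hx.indep _ hs) h0)

variable [IsManifold (𝓡 k) ∞ S] [IsManifold (𝓡∂ (k + 1)) ∞ H]

section

variable (hD : D.IsCHD) (hi : ContMDiff (𝓡 k) (𝓡∂ (k + 1)) ∞ i) (had : IsAdapted D i)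
  (hpos : ∀ s X, X ≠ 0 → 0 < D.γ (i s) (push i s X) (push i s X))
  (hg : g * gram (sliceMetric D i s (extChartAt (𝓡 k) s s)) = 1)

theorem gram_sliceMetric (D : HypersurfaceData k H) (hi : ContMDiff (𝓡 k) (𝓡∂ (k + 1)) ∞ i)
    (s : S) : gram (inducedMetric (D.inChart (i s)) (sliceMap i s) (extChartAt (𝓡 k) s s))
      = gram (sliceMetric D i s (extChartAt (𝓡 k) s s)) := by
  ext a b
  exact (inducedMetric_sliceMap D hi s).self_of_nhds _ _

include hD hi had hpos in
theorem isUnit_gram_sliceMetric (s : S) :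
    IsUnit (gram (sliceMetric D i s (extChartAt (𝓡 k) s s))) := by
  rw [← gram_sliceMetric D hi s]
  exact (hD.adaptedSlice hi had hpos s).isUnit_gram

include hD hi had hpos hg

theorem trK_eq_sum : D.trK (i s) = ∑ a, ∑ b, g a b *
    D.K (i s) (push i s (basisVec a)) (push i s (basisVec b)) := by
  have hA := hD.adaptedSlice hi had hpos s
  rw [← gram_sliceMetric D hi s] at hg
  have h := hA.trP_eq_sum hg
    (T := (D.inChart (i s)).K (halfSpace k) (sliceMap i s (extChartAt (𝓡 k) s s))) ((D.inChart (i s)).isLinearMap_K_right (halfSpace k) _)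
    ((D.inChart (i s)).isLinearMap_K_left (halfSpace k) _)
  simp only [fderiv_sliceMap_self hi, sliceMap_self] at h
  exact h

theorem nablaNEll_eq (X : TangentSpace (𝓡∂ (k + 1)) (i s)) :
    D.nablaNEll (i s) X = D.Pi (i s) X (D.n (i s)) + D.lieNell (i s) X := by
  have hA := hD.adaptedSlice hi had hpos s
  rw [← gram_sliceMetric D hi s] at hg
  have h := hA.covEll_n hg X
  simp only [sliceMap_self] at h
  exact h

theorem n_ell₂_eq_sum {u : H → ℝ} (hu : D.IsFoliationFunction u)
    (hconst : ∀ s t, u (i s) = u (i t))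
    (hharm : mvfderiv (𝓡∂ (k + 1)) u (i s) (D.harmonicVec (i s)) = D.boxP u (i s)) :
    mvfderiv (𝓡∂ (k + 1)) D.ℓ₂ (i s) (D.n (i s)) = ∑ a, ∑ b, g a b *
      D.Y (i s) (push i s (basisVec a)) (push i s (basisVec b)) := by
  have hA := hD.adaptedSlice hi had hpos s
  rw [← gram_sliceMetric D hi s] at hg
  have hmu := (hu.1 (i s)).mdifferentiableAt (by simp)
  have h1 := hu.2 (i s)
  rw [HypersurfaceData.lam, mvfderiv_eq_fderivWithin hmu] at h1
  rw [mvfderiv_eq_fderivWithin hmu] at hharm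
  have h := hA.n_ell₂_eq hg (f := fun y => u ((extChartAt (𝓡∂ (k + 1)) (i s)).symm y))
    (by
      rw [sliceMap_self]
      exact contDiffWithinAt_infty.1 (contDiffWithinAt_inChart (hu.1 (i s))) 2)
    ⟨u (i s), (sliceMap_comp hi.continuous s u).trans
      (Filter.Eventually.of_forall fun x => hconst _ _)⟩
    (by rw [sliceMap_self]; exact h1) (by rw [sliceMap_self]; exact hharm)
  simp only [fderiv_sliceMap_self hi, sliceMap_self] at h
  rw [mvfderiv_eq_fderivWithin ((hD.smooth_ℓ₂ (i s)).mdifferentiableAt (by simp))]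
  refine h.trans (Finset.sum_congr rfl fun a _ => Finset.sum_congr rfl fun b _ => ?_)
  exact congrArg _ (tensorInChart_self D.Y (i s) _ _)

/-- The right side sees only the induced metric and `f ∘ i`, which is what makes the two data
comparable. -/
theorem harmonic_slice {f : H → ℝ} (hf : ContMDiffAt (𝓡∂ (k + 1)) 𝓘(ℝ, ℝ) ∞ f (i s))
    (hY : mvfderiv (𝓡∂ (k + 1)) D.ℓ₂ (i s) (D.n (i s)) = ∑ a, ∑ b, g a b *
      D.Y (i s) (push i s (basisVec a)) (push i s (basisVec b)))
    (hharm : mvfderiv (𝓡∂ (k + 1)) f (i s) (D.harmonicVec (i s)) = D.boxP f (i s)) :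
    2 * ∑ a, ∑ b, g a b * (D.nablaNEll (i s) (push i s (basisVec a))
        * fderiv ℝ (fun x => f (i ((extChartAt (𝓡 k) s).symm x))) (extChartAt (𝓡 k) s s)
          (basisVec b))
      = metricBox g (sliceMetric D i s) (fun x => f (i ((extChartAt (𝓡 k) s).symm x)))
        (extChartAt (𝓡 k) s s) := by
  have hA := hD.adaptedSlice hi had hpos s
  rw [← gram_sliceMetric D hi s] at hg
  rw [mvfderiv_eq_fderivWithin (hf.mdifferentiableAt (by simp))] at hharm
  rw [mvfderiv_eq_fderivWithin ((hD.smooth_ℓ₂ (i s)).mdifferentiableAt (by simp))] at hY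
  have h := hA.harmonic_tangent hg (f := fun y => f ((extChartAt (𝓡∂ (k + 1)) (i s)).symm y))
    (by
      rw [sliceMap_self]
      exact contDiffWithinAt_infty.1 (contDiffWithinAt_inChart hf) 2)
    (by
      simp only [fderiv_sliceMap_self hi, sliceMap_self]
      refine hY.trans (Finset.sum_congr rfl fun a _ => Finset.sum_congr rfl fun b _ => ?_)
      exact congrArg _ (tensorInChart_self D.Y (i s) _ _).symm)
    (by rw [sliceMap_self]; exact hharm)
  have hc := sliceMap_comp (k := k) hi.continuous s f
  have he : ∀ᶠ x in 𝓝 (extChartAt (𝓡 k) s s), ∀ v w, inducedMetric (D.inChart (i s))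
      (sliceMap i s) x v w = sliceMetric D i s x v w := inducedMetric_sliceMap D hi s
  rw [← metricBox_congr he hc, ← hc.fderiv_eq]
  refine Eq.trans ?_ h
  simp only [fderiv_sliceMap_self hi, sliceMap_self]
  rfl

end

end OneSide

theorem HypersurfaceData.IsHarmonicGaugeOn.apply_eq {k : ℕ} {H : Type*}
    [TopologicalSpace H] [ChartedSpace (EuclideanHalfSpace (k + 1)) H] {D : HypersurfaceData k H}
    {x : Fin (k + 1) → H → ℝ} {U : Set H} (h : D.IsHarmonicGaugeOn x U) {p : H} (hp : p ∈ U)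
    (a : Fin (k + 1)) : mvfderiv (𝓡∂ (k + 1)) (x a) p (D.harmonicVec p) = D.boxP (x a) p := by
  obtain ⟨V, hV⟩ := h.vector_eq
  rw [(hV p hp).2]
  exact (hV p hp).1 a

/-! ### Comparison of the two data -/

section Pair

variable {k : ℕ} {S : Type*} [TopologicalSpace S] [ChartedSpace (EuclideanSpace ℝ (Fin k)) S]
  [IsManifold (𝓡 k) ∞ S]
  {H₁ : Type*} [TopologicalSpace H₁] [ChartedSpace (EuclideanHalfSpace (k + 1)) H₁]
  [IsManifold (𝓡∂ (k + 1)) ∞ H₁]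
  {H₂ : Type*} [TopologicalSpace H₂] [ChartedSpace (EuclideanHalfSpace (k + 1)) H₂]
  [IsManifold (𝓡∂ (k + 1)) ∞ H₂]
  {D₁ : HypersurfaceData k H₁} {D₂ : HypersurfaceData k H₂} {i₁ : S → H₁} {i₂ : S → H₂} {μ : S → ℝ}

/-- Compatibility is postulated for every adapted gauge transform; here the identity transformation
is chosen. -/
theorem IsDoubleNullData.isCompatible (h : IsDoubleNullData D₁ D₂ i₁ i₂ μ)
    (h₁ : IsAdapted D₁ i₁) (h₂ : IsAdapted D₂ i₂) : IsCompatible D₁ D₂ i₁ i₂ μ := by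
  have := h.compatible (fun _ => 1) (fun _ => 0) (fun _ => 1) (fun _ => 0)
    isGaugeParam_one_zero isGaugeParam_one_zero
  simp only [HypersurfaceData.gauge_one_zero, inv_one, one_mul] at this
  exact this h₁ h₂

theorem IsDoubleNullData.metric_pos₂ (h : IsDoubleNullData D₁ D₂ i₁ i₂ μ) (s : S)
    (X : TangentSpace (𝓡 k) s) (hX : X ≠ 0) : 0 < D₂.γ (i₂ s) (push i₂ s X) (push i₂ s X) := by
  rw [← h.metric_eq]
  exact h.metric_pos s X hX

theorem IsDoubleNullData.sliceMetric_eq (h : IsDoubleNullData D₁ D₂ i₁ i₂ μ) (s : S) :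
    sliceMetric D₁ i₁ s = sliceMetric D₂ i₂ s := by
  funext x v w
  exact h.metric_eq _ _ _

/-- One matrix serves both sides, so that traces of the two data can be equated term by term. -/
theorem IsDoubleNullData.exists_inverse_gram (h : IsDoubleNullData D₁ D₂ i₁ i₂ μ)
    (h₁ : IsAdapted D₁ i₁) (s : S) : ∃ g : Matrix (Fin k) (Fin k) ℝ,
      g * gram (sliceMetric D₁ i₁ s (extChartAt (𝓡 k) s s)) = 1 ∧
      g * gram (sliceMetric D₂ i₂ s (extChartAt (𝓡 k) s s)) = 1 := by
  have hu := isUnit_gram_sliceMetric h.chd₁ h.embed₁.contMDiff h₁ h.metric_pos s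
  rw [← h.sliceMetric_eq]
  exact ⟨_, Matrix.nonsing_inv_mul _ ((Matrix.isUnit_iff_isUnit_det _).1 hu),
    Matrix.nonsing_inv_mul _ ((Matrix.isUnit_iff_isUnit_det _).1 hu)⟩

/-- In the harmonic gauge, the one-forms `∇̄_n ℓ` of the two data agree on the boundary. -/
theorem IsDoubleNullData.nablaNEll_eq (h : IsDoubleNullData D₁ D₂ i₁ i₂ μ)
    (h₁ : IsAdapted D₁ i₁) (h₂ : IsAdapted D₂ i₂)
    {u₁ : H₁ → ℝ} {u₂ : H₂ → ℝ}
    (hu₁ : D₁.IsFoliationFunction u₁) (hu₂ : D₂.IsFoliationFunction u₂)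
    (hconst₁ : ∀ s t, u₁ (i₁ s) = u₁ (i₁ t)) (hconst₂ : ∀ s t, u₂ (i₂ s) = u₂ (i₂ t))
    {U₁ : Set H₁} {U₂ : Set H₂} (hU₁ : IsOpen U₁) (hU₂ : IsOpen U₂)
    {x₁ : Fin k → H₁ → ℝ} {x₂ : Fin k → H₂ → ℝ}
    (hx₁ : IsIndependentOn (Fin.cons u₁ x₁ : Fin (k + 1) → H₁ → ℝ) U₁)
    (hx₂ : IsIndependentOn (Fin.cons u₂ x₂ : Fin (k + 1) → H₂ → ℝ) U₂)
    (hx : ∀ s, i₁ s ∈ U₁ → i₂ s ∈ U₂ → ∀ a, x₁ a (i₁ s) = x₂ a (i₂ s))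
    (hharm₁ : D₁.IsHarmonicGaugeOn (Fin.cons u₁ x₁ : Fin (k + 1) → H₁ → ℝ) U₁)
    (hharm₂ : D₂.IsHarmonicGaugeOn (Fin.cons u₂ x₂ : Fin (k + 1) → H₂ → ℝ) U₂)
    {s : S} (hs₁ : i₁ s ∈ U₁) (hs₂ : i₂ s ∈ U₂) (X : TangentSpace (𝓡 k) s) :
    D₁.nablaNEll (i₁ s) (push i₁ s X) = D₂.nablaNEll (i₂ s) (push i₂ s X) := by
  have hi₁ := h.embed₁.contMDiff
  have hi₂ := h.embed₂.contMDiff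
  obtain ⟨g, hg₁, hg₂⟩ := h.exists_inverse_gram h₁ s
  -- `U₁` and `U₂` are open, so the functions agree on a neighbourhood in `S`, as second derivatives
  -- require.
  have hev : ∀ a, (fun y => x₁ a (i₁ ((extChartAt (𝓡 k) s).symm y)))
      =ᶠ[𝓝 (extChartAt (𝓡 k) s s)] fun y => x₂ a (i₂ ((extChartAt (𝓡 k) s).symm y)) := by
    have hc₁ := hi₁.continuous.continuousAt.comp (continuousAt_extChartAt_symm (I := 𝓡 k) s)
    have hc₂ := hi₂.continuous.continuousAt.comp (continuousAt_extChartAt_symm (I := 𝓡 k) s)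
    intro a
    filter_upwards [hc₁.eventually (p := (· ∈ U₁))
        (by rw [comp_apply, extChartAt_to_inv]; exact hU₁.mem_nhds hs₁),
      hc₂.eventually (p := (· ∈ U₂))
        (by rw [comp_apply, extChartAt_to_inv]; exact hU₂.mem_nhds hs₂)] with y hy₁ hy₂
    exact hx _ hy₁ hy₂ a
  set δ : Fin k → ℝ := fun a => D₁.nablaNEll (i₁ s) (push i₁ s (basisVec a))
    - D₂.nablaNEll (i₂ s) (push i₂ s (basisVec a)) with hδ
  -- The vector is the difference `δ` of the two one-forms with its index raised by `g`. Each `dx^a`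
  -- kills it, since both one-forms have the same contraction, half the Laplacian of `x^a`.
  have hzero : ∀ a, fderiv ℝ (fun y => x₁ a (i₁ ((extChartAt (𝓡 k) s).symm y)))
      (extChartAt (𝓡 k) s s) (WithLp.toLp 2 (Matrix.vecMul δ g)) = 0 := by
    intro a
    have e₁ := harmonic_slice h.chd₁ hi₁ h₁ h.metric_pos hg₁ (f := x₁ a)
      ((hx₁.smooth a.succ).contMDiffAt (hU₁.mem_nhds hs₁))
      (n_ell₂_eq_sum h.chd₁ hi₁ h₁ h.metric_pos hg₁ hu₁ hconst₁ (hharm₁.apply_eq hs₁ 0))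
      (hharm₁.apply_eq hs₁ a.succ)
    have e₂ := harmonic_slice h.chd₂ hi₂ h₂ h.metric_pos₂ hg₂ (f := x₂ a)
      ((hx₂.smooth a.succ).contMDiffAt (hU₂.mem_nhds hs₂))
      (n_ell₂_eq_sum h.chd₂ hi₂ h₂ h.metric_pos₂ hg₂ hu₂ hconst₂ (hharm₂.apply_eq hs₂ 0))
      (hharm₂.apply_eq hs₂ a.succ)
    rw [h.sliceMetric_eq, metricBox_congr (Filter.Eventually.of_forall fun _ _ _ => rfl) (hev a),
      ← e₂, ← (hev a).fderiv_eq] at e₁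
    refine (IsLinearMap.eq_sum (fderiv ℝ (fun y => x₁ a (i₁ ((extChartAt (𝓡 k) s).symm y)))
      (extChartAt (𝓡 k) s s)).toLinearMap.isLinear _).trans ?_
    simp only [Matrix.vecMul, dotProduct, Finset.sum_mul]
    rw [Finset.sum_comm]
    have e₃ := sub_eq_zero.2 (mul_left_cancel₀ two_ne_zero e₁)
    rw [← e₃, ← Finset.sum_sub_distrib]
    refine Finset.sum_congr rfl fun b _ => ?_
    rw [← Finset.sum_sub_distrib]
    refine Finset.sum_congr rfl fun c _ => ?_
    simp only [hδ, ContinuousLinearMap.coe_coe]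
    ring
  have hv := eq_zero_of_independent hi₁ h.metric_pos hU₁ hx₁ hs₁ hconst₁ hzero
  -- Lowering the index again with the Gram matrix.
  have hδ0 : δ = 0 := by
    have h1 : Matrix.vecMul δ g = 0 := by simpa using hv
    rw [← Matrix.vecMul_one δ, ← hg₁, ← Matrix.vecMul_vecMul, h1, Matrix.zero_vecMul]
  refine ((isLinearMap_nablaNEll D₁ i₁ s).eq_sum X).trans
    (Eq.trans ?_ ((isLinearMap_nablaNEll D₂ i₂ s).eq_sum X).symm)
  exact Finset.sum_congr rfl fun a _ => congrArg _ (sub_eq_zero.1 (congrFun hδ0 a))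

end Pair

/-! ### The proposition -/

theorem mainTheorem8 {k : ℕ}
    {S : Type*} [TopologicalSpace S] [T2Space S] [SecondCountableTopology S]
    [ChartedSpace (EuclideanSpace ℝ (Fin k)) S] [IsManifold (𝓡 k) ∞ S]
    {H₁ : Type*} [TopologicalSpace H₁] [T2Space H₁] [SecondCountableTopology H₁]
    [ChartedSpace (EuclideanHalfSpace (k + 1)) H₁] [IsManifold (𝓡∂ (k + 1)) ∞ H₁]
    {H₂ : Type*} [TopologicalSpace H₂] [T2Space H₂] [SecondCountableTopology H₂]
    [ChartedSpace (EuclideanHalfSpace (k + 1)) H₂] [IsManifold (𝓡∂ (k + 1)) ∞ H₂]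
    (D₁ : HypersurfaceData k H₁) (D₂ : HypersurfaceData k H₂)
    (i₁ : S → H₁) (i₂ : S → H₂) (μ : S → ℝ)
    (hDND : IsDoubleNullData D₁ D₂ i₁ i₂ μ)
    -- the foliation functions, constant on the common boundary
    (u₁ : H₁ → ℝ) (u₂ : H₂ → ℝ)
    (hu₁ : D₁.IsFoliationFunction u₁) (hu₂ : D₂.IsFoliationFunction u₂)
    (hconst₁ : ∀ s t, u₁ (i₁ s) = u₁ (i₁ t)) (hconst₂ : ∀ s t, u₂ (i₂ s) = u₂ (i₂ t))
    -- the remaining functions, independent on open sets and equal on the common boundary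
    (U₁ : Set H₁) (U₂ : Set H₂) (hU₁ : IsOpen U₁) (hU₂ : IsOpen U₂)
    (x₁ : Fin k → H₁ → ℝ) (x₂ : Fin k → H₂ → ℝ)
    (hx₁ : IsIndependentOn (Fin.cons u₁ x₁ : Fin (k + 1) → H₁ → ℝ) U₁)
    (hx₂ : IsIndependentOn (Fin.cons u₂ x₂ : Fin (k + 1) → H₂ → ℝ) U₂)
    (hx : ∀ s, i₁ s ∈ U₁ → i₂ s ∈ U₂ → ∀ a, x₁ a (i₁ s) = x₂ a (i₂ s))
    -- the harmonic gauge
    (hharm₁ : D₁.IsHarmonicGaugeOn (Fin.cons u₁ x₁ : Fin (k + 1) → H₁ → ℝ) U₁)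
    (hharm₂ : D₂.IsHarmonicGaugeOn (Fin.cons u₂ x₂ : Fin (k + 1) → H₂ → ℝ) U₂)
    (hadapt₁ : IsAdapted D₁ i₁) (hadapt₂ : IsAdapted D₂ i₂)
    (hμ₁ : ∀ s, μ s = D₁.lam u₁ (i₁ s)) (hμ₂ : ∀ s, μ s = D₂.lam u₂ (i₂ s)) :
    ∀ s, i₁ s ∈ U₁ → i₂ s ∈ U₂ →
      2 * D₁.Y (i₁ s) (D₁.n (i₁ s)) (D₁.n (i₁ s))
          = D₂.lam u₂ (i₂ s) * mvfderiv (𝓡∂ (k + 1)) D₂.ℓ₂ (i₂ s) (D₂.n (i₂ s)) ∧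
      2 * D₂.Y (i₂ s) (D₂.n (i₂ s)) (D₂.n (i₂ s))
          = D₁.lam u₁ (i₁ s) * mvfderiv (𝓡∂ (k + 1)) D₁.ℓ₂ (i₁ s) (D₁.n (i₁ s)) ∧
      ∀ X : TangentSpace (𝓡 k) s,
        2 * D₁.Pi (i₁ s) (push i₁ s X) (D₁.n (i₁ s))
            = D₂.lieNell (i₂ s) (push i₂ s X)
              - mvfderiv (𝓡 k) (fun t => Real.log |D₂.lam u₂ (i₂ t)|) s X
              - D₁.lieNell (i₁ s) (push i₁ s X) ∧
        2 * D₂.Pi (i₂ s) (push i₂ s X) (D₂.n (i₂ s))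
            = D₁.lieNell (i₁ s) (push i₁ s X)
              - mvfderiv (𝓡 k) (fun t => Real.log |D₁.lam u₁ (i₁ t)|) s X
              - D₂.lieNell (i₂ s) (push i₂ s X) := by

  intro s hs₁ hs₂
  have hi₁ := hDND.embed₁.contMDiff
  have hi₂ := hDND.embed₂.contMDiff
  have hμ := (hDND.μ_neg s).ne
  have hc := hDND.isCompatible hadapt₁ hadapt₂
  obtain ⟨g, hg₁, hg₂⟩ := hDND.exists_inverse_gram hadapt₁ s
  have hK₁ := trK_eq_sum hDND.chd₁ hi₁ hadapt₁ hDND.metric_pos hg₁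
  have hK₂ := trK_eq_sum hDND.chd₂ hi₂ hadapt₂ hDND.metric_pos₂ hg₂
  have hY₁ := n_ell₂_eq_sum hDND.chd₁ hi₁ hadapt₁ hDND.metric_pos hg₁ hu₁ hconst₁
    (hharm₁.apply_eq hs₁ 0)
  have hY₂ := n_ell₂_eq_sum hDND.chd₂ hi₂ hadapt₂ hDND.metric_pos₂ hg₂ hu₂ hconst₂
    (hharm₂.apply_eq hs₂ 0)
  have ht₁ := hharm₁.trace_eq _ hs₁
  have ht₂ := hharm₂.trace_eq _ hs₂
  rw [HypersurfaceData.omega] at ht₁ ht₂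
  -- Compatibility replaces `Y` by `μ⁻¹ K` of the other data. As `g` is common to both, the sum
  -- becomes the other trace of `K`.
  replace hY₁ := hY₁.trans (Finset.sum_congr rfl fun a _ => Finset.sum_congr rfl fun b _ =>
    congrArg (g a b * ·) (hc.Y₁_eq s (basisVec a) (basisVec b)))
  replace hY₂ := hY₂.trans (Finset.sum_congr rfl fun a _ => Finset.sum_congr rfl fun b _ =>
    congrArg (g a b * ·) (hc.Y₂_eq s (basisVec a) (basisVec b)))
  simp only [mul_left_comm (g _ _), ← Finset.mul_sum] at hY₁ hY₂
  rw [← hK₂] at hY₁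
  rw [← hK₁] at hY₂
  refine ⟨?_, ?_, fun X => ?_⟩
  · rw [← hμ₂, hY₂, mul_inv_cancel_left₀ hμ]
    -- The trace condition in the form `tr_P K = 4ω = 2 Y(n, n)`.
    linarith
  · rw [← hμ₁, hY₁, mul_inv_cancel_left₀ hμ]
    linarith
  · have ha := hDND.nablaNEll_eq hadapt₁ hadapt₂ hu₁ hu₂ hconst₁ hconst₂ hU₁ hU₂ hx₁ hx₂ hx
      hharm₁ hharm₂ hs₁ hs₂ X
    rw [nablaNEll_eq hDND.chd₁ hi₁ hadapt₁ hDND.metric_pos hg₁,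
      nablaNEll_eq hDND.chd₂ hi₂ hadapt₂ hDND.metric_pos₂ hg₂] at ha
    have ht := hc.torsion s X
    simp only [← hμ₁, ← hμ₂]
    -- `ha` gives the difference of the two torsion terms and `ht` their sum.
    constructor <;> linarith
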